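/- Let $n\ge 8$ be an integer divisible by $4$, and put $\zeta_n=e^{2\pi i/n}$, $R_n=\mathbb Z[\zeta_n,1/2]\subset\mathbb C$ and $R_n^+=\mathbb Z[\zeta_n+\overline{\zeta_n},1/2]\subset\mathbb R$. For a subring $A\subseteq\mathbb C$ let $U_2(A)=U_2\cap GL_2(A)$, where $U_2$ is the group of complex unitary $2\times2$ matrices, and let $PU_2(A)$ be the quotient of $U_2(A)$ by its scalar matrices. Let $\mathcal C=U_2(R_4)$ be the Clifford group, let $T_n=\begin{pmatrix}1&0\\0&\zeta_n\end{pmatrix}$, let $\mathcal G_n=\langle\mathcal C,T_n\rangle\le U_2(R_n)$ be the Clifford-cyclotomic group, and let $P\mathcal G_n$ be its image in $PU_2(R_n)$. Let $\pi:U_2\to SO_3(\mathbb R)$ be the homomorphism that sends $g$ to the matrix of $X\mapsto gXg^\dagger$ on the real space of traceless hermitian $2\times2$ matrices, in the Pauli basis $\sigma_x,\sigma_y,\sigma_z$. Let $G(4,n)\le SO_3(\mathbb R)$ be the subgroup generated by the rotation by $2\pi/4$ about the $y$-axis and the rotation by $2\pi/n$ about the $z$-axis. Let $D_m$ be the dihedral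 group of order $2m$ and $S_4$ the symmetric group on $4$ letters. Then: 1. $\pi$ induces an isomorphism $P\mathcal G_n\cong\pi(\mathcal G_n)$, and $\pi(\mathcal G_n)\le SO_3(R_n^+)$; 2. $\pi(\mathcal G_n)=G(4,n)$; 3. $G(4,n)\cong S_4*_{D_4}D_n$, the amalgamated product for the embedding $D_4\hookrightarrow S_4$ given by the action of the symmetries of a square on its four vertices and the embedding $D_4\hookrightarrow D_n$ that sends a rotation $r$ of order $4$ to $\rho^{n/4}$, where $\rho$ generates the rotations of $D_n$, and a reflection to a reflection. -/

import Mathlib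

namespace CliffordCyclotomic

open Matrix Complex

noncomputable section

/-- The group of complex unitary `2 × 2` matrices. -/
abbrev U2C : Type := Matrix.unitaryGroup (Fin 2) ℂ

/-- The group of real orthogonal `3 × 3` matrices of determinant `1`. -/
abbrev SO3 : Type := Matrix.specialOrthogonalGroup (Fin 3) ℝ

/-- `ζ_n = exp (2 π i / n)`. -/
def zeta (n : ℕ) : ℂ := Complex.exp (2 * Real.pi * Complex.I / n)

/-- `R_n = ℤ[ζ_n, 1/2]`, a subring of `ℂ`. -/
def R (n : ℕ) : Subring ℂ := Subring.closure {zeta n, 1 / 2}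

/-- `R_n⁺ = ℤ[ζ_n + conj ζ_n, 1/2]`, a subring of `ℝ`; here `ζ_n + conj ζ_n = 2 Re ζ_n`. -/
def Rplus (n : ℕ) : Subring ℝ := Subring.closure {2 * (zeta n).re, 1 / 2}

/-- `U₂(A) = U₂ ∩ GL₂(A)` for a subring `A` of `ℂ`: the matrix and its inverse have
entries in `A`. -/
def U2 (A : Subring ℂ) : Subgroup U2C where
  carrier := {g | (∀ i j, (g : Matrix (Fin 2) (Fin 2) ℂ) i j ∈ A) ∧
    ∀ i j, ((g⁻¹ : U2C) : Matrix (Fin 2) (Fin 2) ℂ) i j ∈ A}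
  one_mem' := by
    constructor <;> intro i j <;> fin_cases i <;> fin_cases j <;> simp [A.one_mem, A.zero_mem]
  mul_mem' := by
    rintro g h ⟨hg, hg'⟩ ⟨hh, hh'⟩
    constructor <;> intro i j
    · rw [Matrix.UnitaryGroup.mul_val, Matrix.mul_apply]
      exact A.sum_mem fun k _ => A.mul_mem (hg i k) (hh k j)
    · rw [_root_.mul_inv_rev, Matrix.UnitaryGroup.mul_val, Matrix.mul_apply]
      exact A.sum_mem fun k _ => A.mul_mem (hh' i k) (hg' k j)
  inv_mem' := by
    rintro g ⟨hg, hg'⟩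
    exact ⟨hg', by simpa using hg⟩

/-- `SO₃(B)` for a subring `B` of `ℝ`. The inverse of an orthogonal matrix is its transpose, so
it again has entries in `B`. -/
def SO3R (B : Subring ℝ) : Subgroup SO3 where
  carrier := {g | ∀ i j, (g : Matrix (Fin 3) (Fin 3) ℝ) i j ∈ B}
  one_mem' := by
    intro i j
    fin_cases i <;> fin_cases j <;> simp [B.one_mem, B.zero_mem]
  mul_mem' := by
    intro g h hg hh i j
    change ((g : Matrix (Fin 3) (Fin 3) ℝ) * (h : Matrix (Fin 3) (Fin 3) ℝ)) i j ∈ B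
    rw [Matrix.mul_apply]
    exact B.sum_mem fun k _ => B.mul_mem (hg i k) (hh k j)
  inv_mem' := by
    intro g hg i j
    exact hg j i

/-- The subgroup of scalar matrices in `U₂(A)`. -/
def scalars (A : Subring ℂ) : Subgroup (U2 A) where
  carrier := {g | ∃ c : ℂ, ((g : U2C) : Matrix (Fin 2) (Fin 2) ℂ) = c • 1}
  one_mem' := ⟨1, by simp⟩
  mul_mem' := by
    rintro g h ⟨c, hc⟩ ⟨d, hd⟩
    exact ⟨c * d, by simp [hc, hd, smul_smul, mul_comm]⟩
  inv_mem' := by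
    rintro g ⟨c, hc⟩
    refine ⟨star c, ?_⟩
    change star ((g : U2C) : Matrix (Fin 2) (Fin 2) ℂ) = _
    rw [hc]
    simp

instance (A : Subring ℂ) : (scalars A).Normal where
  conj_mem := by
    rintro g ⟨c, hc⟩ h
    refine ⟨c, ?_⟩
    have e : h * g * h⁻¹ = g := by
      have : h * g = g * h := by
        apply Subtype.ext
        apply Subtype.ext
        simp [hc]
      rw [this]
      simp
    rw [e, hc]

/-- `PU₂(A)`: the quotient of `U₂(A)` by its scalar matrices. -/
abbrev PU2 (A : Subring ℂ) : Type := U2 A ⧸ scalars A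

lemma star_zeta_mul (n : ℕ) : star (zeta n) * zeta n = 1 := by
  have h : ‖zeta n‖ = 1 := by
    have : zeta n = Complex.exp (((2 * Real.pi / n : ℝ) : ℂ) * Complex.I) := by
      unfold zeta
      congr 1
      push_cast
      ring
    rw [this, Complex.norm_exp_ofReal_mul_I]
  change (starRingEnd ℂ) (zeta n) * zeta n = 1
  rw [mul_comm, Complex.mul_conj, Complex.normSq_eq_norm_sq, h]
  simp

/-- `T_n = diag (1, ζ_n)`. -/
def T (n : ℕ) : U2C :=
  ⟨!![1, 0; 0, zeta n], by
    rw [Matrix.mem_unitaryGroup_iff']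
    ext i j
    have h := star_zeta_mul n
    fin_cases i <;> fin_cases j <;>
      simp [Matrix.mul_apply, Matrix.star_apply, Fin.sum_univ_two]
    simpa using h⟩

/-- The Clifford group `𝒞 = U₂(R_4) = U₂(ℤ[i, 1/2])`. -/
def clifford : Subgroup U2C := U2 (R 4)

/-- The Clifford-cyclotomic group `𝒢_n = ⟨𝒞, T_n⟩`. -/
def G (n : ℕ) : Subgroup U2C := Subgroup.closure ((clifford : Set U2C) ∪ {T n})

lemma zeta_pow_self {n : ℕ} (hn : n ≠ 0) : zeta n ^ n = 1 := by
  unfold zeta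
  exact (Complex.isPrimitiveRoot_exp n hn).pow_eq_one

lemma R_four_le {n : ℕ} (h4 : 4 ∣ n) (hn : n ≠ 0) : R 4 ≤ R n := by
  obtain ⟨m, rfl⟩ := h4
  refine Subring.closure_le.2 ?_
  rintro x (rfl | rfl)
  · have hm : (m : ℂ) ≠ 0 := by
      have : m ≠ 0 := by rintro rfl; simp at hn
      exact_mod_cast this
    have : zeta 4 = zeta (4 * m) ^ m := by
      unfold zeta
      rw [← Complex.exp_nat_mul]
      congr 1
      push_cast
      field_simp
    rw [this]
    exact (R (4 * m)).pow_mem (Subring.subset_closure (by simp)) m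
  · exact Subring.subset_closure (by simp)

/-- For `4 ∣ n` the Clifford-cyclotomic group lies in `U₂(R_n)`. -/
lemma G_le_U2 {n : ℕ} (h4 : 4 ∣ n) (hn : n ≠ 0) : G n ≤ U2 (R n) := by
  refine (Subgroup.closure_le _).2 (Set.union_subset ?_ ?_)
  · rintro g ⟨h, h'⟩
    exact ⟨fun i j => R_four_le h4 hn (h i j), fun i j => R_four_le h4 hn (h' i j)⟩
  · rintro _ rfl
    have hz : zeta n ∈ R n := Subring.subset_closure (by simp)
    have hz' : star (zeta n) ∈ R n := by
      have : star (zeta n) = zeta n ^ (n - 1) := by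
        have h1 : zeta n ≠ 0 := Complex.exp_ne_zero _
        apply mul_right_cancel₀ h1
        rw [star_zeta_mul, ← pow_succ, Nat.sub_add_cancel (Nat.one_le_iff_ne_zero.2 hn),
          zeta_pow_self hn]
      rw [this]
      exact (R n).pow_mem hz _
    constructor <;> intro i j
    · fin_cases i <;> fin_cases j <;> simp [T, hz, (R n).zero_mem, (R n).one_mem]
    · change star (T n : Matrix (Fin 2) (Fin 2) ℂ) i j ∈ R n
      fin_cases i <;> fin_cases j <;>
        simp [T, Matrix.star_apply, (R n).zero_mem, (R n).one_mem]
      simpa using hz'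

/-- `P𝒢_n`: the image of `𝒢_n` in `PU₂(R_n)`. -/
def PG (n : ℕ) : Subgroup (PU2 (R n)) :=
  ((G n).subgroupOf (U2 (R n))).map (QuotientGroup.mk' (scalars (R n)))

/-- The Pauli matrices `σ_x, σ_y, σ_z`, an orthonormal basis of the real space of traceless
hermitian `2 × 2` matrices for the form `⟨A, B⟩ = Tr (A B) / 2`. -/
def pauli : Fin 3 → Matrix (Fin 2) (Fin 2) ℂ :=
  ![!![0, 1; 1, 0], !![0, -Complex.I; Complex.I, 0], !![1, 0; 0, -1]]

/-- The matrix, in the Pauli basis, of `X ↦ g X g†` on traceless hermitian matrices: its `(i, j)`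
entry is the `σ_i`-coordinate `Tr (σ_i (g σ_j g†)) / 2` of `g σ_j g†`. -/
def adMatrix (g : Matrix (Fin 2) (Fin 2) ℂ) : Matrix (Fin 3) (Fin 3) ℝ :=
  Matrix.of fun i j => ((pauli i * (g * pauli j * gᴴ)).trace / 2).re

lemma pauli_conjTranspose (j : Fin 3) : (pauli j)ᴴ = pauli j := by
  fin_cases j <;> ext a b <;> fin_cases a <;> fin_cases b <;>
    simp [pauli, Matrix.conjTranspose_apply]

lemma pauli_trace (j : Fin 3) : (pauli j).trace = 0 := by
  fin_cases j <;> simp [pauli, Matrix.trace_fin_two]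

/-- Expansion of a traceless hermitian matrix in the Pauli basis. -/
lemma pauli_expansion (X : Matrix (Fin 2) (Fin 2) ℂ) (hX : Xᴴ = X) (h0 : X.trace = 0) :
    X = ∑ i, ((((pauli i * X).trace / 2).re : ℝ) : ℂ) • pauli i := by
  have h00 := congrFun (congrFun hX 0) 0
  have h10 := congrFun (congrFun hX 1) 0
  have h11 := congrFun (congrFun hX 1) 1
  rw [Matrix.trace_fin_two] at h0
  simp only [Matrix.conjTranspose_apply, Complex.ext_iff, Complex.star_def, Complex.conj_re,
    Complex.conj_im, Complex.add_re, Complex.add_im, Complex.zero_re, Complex.zero_im]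
    at h00 h10 h11 h0
  obtain ⟨h0, h0'⟩ := h0
  obtain ⟨h10, h10'⟩ := h10
  ext a b
  fin_cases a <;> fin_cases b <;>
    simp [pauli, Fin.sum_univ_three, Matrix.trace_fin_two, Matrix.mul_apply, Complex.ext_iff,
      Matrix.sum_apply] <;>
    constructor <;> linarith

lemma conj_pauli_hermitian (g : Matrix (Fin 2) (Fin 2) ℂ) (j : Fin 3) :
    (g * pauli j * gᴴ)ᴴ = g * pauli j * gᴴ := by
  simp [Matrix.conjTranspose_mul, pauli_conjTranspose, Matrix.mul_assoc]

lemma U2C_star_mul (g : U2C) :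
    (g : Matrix (Fin 2) (Fin 2) ℂ)ᴴ * (g : Matrix (Fin 2) (Fin 2) ℂ) = 1 :=
  Matrix.mem_unitaryGroup_iff'.1 g.2

lemma U2C_mul_star (g : U2C) :
    (g : Matrix (Fin 2) (Fin 2) ℂ) * (g : Matrix (Fin 2) (Fin 2) ℂ)ᴴ = 1 :=
  Matrix.mem_unitaryGroup_iff.1 g.2

/-- For unitary `g`, `adMatrix g` is the matrix of conjugation by `g` in the Pauli basis. -/
lemma conj_pauli (g : U2C) (j : Fin 3) :
    (g : Matrix (Fin 2) (Fin 2) ℂ) * pauli j * (g : Matrix (Fin 2) (Fin 2) ℂ)ᴴ =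
      ∑ i, ((adMatrix g i j : ℝ) : ℂ) • pauli i := by
  refine pauli_expansion _ (conj_pauli_hermitian _ j) ?_
  rw [Matrix.trace_mul_comm, ← Matrix.mul_assoc, U2C_star_mul, Matrix.one_mul, pauli_trace]

lemma adMatrix_one : adMatrix 1 = 1 := by
  ext i j
  fin_cases i <;> fin_cases j <;>
    simp [adMatrix, pauli, Matrix.trace_fin_two]

lemma adMatrix_mul (g : Matrix (Fin 2) (Fin 2) ℂ) (h : U2C) :
    adMatrix (g * (h : Matrix (Fin 2) (Fin 2) ℂ)) = adMatrix g * adMatrix h := by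
  ext i j
  have e : g * (h : Matrix (Fin 2) (Fin 2) ℂ) * pauli j *
      (g * (h : Matrix (Fin 2) (Fin 2) ℂ))ᴴ =
      ∑ k, ((adMatrix h k j : ℝ) : ℂ) • (g * pauli k * gᴴ) := by
    calc _ = g * ((h : Matrix (Fin 2) (Fin 2) ℂ) * pauli j *
          (h : Matrix (Fin 2) (Fin 2) ℂ)ᴴ) * gᴴ := by
          simp only [Matrix.conjTranspose_mul, Matrix.mul_assoc]
      _ = _ := by
          rw [conj_pauli]
          simp [Finset.mul_sum, Finset.sum_mul]
  rw [Matrix.mul_apply]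
  change ((pauli i * (g * (h : Matrix (Fin 2) (Fin 2) ℂ) * pauli j *
      (g * (h : Matrix (Fin 2) (Fin 2) ℂ))ᴴ)).trace / 2).re = _
  rw [e]
  simp only [Finset.mul_sum, Matrix.mul_smul, Matrix.trace_sum, Matrix.trace_smul,
    Finset.sum_div, Complex.re_sum, smul_eq_mul, mul_div_assoc, Complex.re_ofReal_mul]
  exact Finset.sum_congr rfl fun k _ => mul_comm _ _

lemma adMatrix_conjTranspose (g : Matrix (Fin 2) (Fin 2) ℂ) :
    adMatrix gᴴ = (adMatrix g)ᵀ := by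
  ext i j
  change ((pauli i * (gᴴ * pauli j * gᴴᴴ)).trace / 2).re =
    ((pauli j * (g * pauli i * gᴴ)).trace / 2).re
  rw [Matrix.conjTranspose_conjTranspose]
  congr 2
  calc (pauli i * (gᴴ * pauli j * g)).trace = ((pauli i * gᴴ) * (pauli j * g)).trace := by
        simp only [Matrix.mul_assoc]
    _ = ((pauli j * g) * (pauli i * gᴴ)).trace := Matrix.trace_mul_comm _ _
    _ = (pauli j * (g * pauli i * gᴴ)).trace := by simp only [Matrix.mul_assoc]

lemma adMatrix_mul_transpose (g : U2C) : adMatrix g * (adMatrix g)ᵀ = 1 := by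
  rw [← adMatrix_conjTranspose]
  have := adMatrix_mul (g : Matrix (Fin 2) (Fin 2) ℂ) (g⁻¹)
  rw [← adMatrix_one, ← U2C_mul_star g]
  exact this.symm

lemma adMatrix_det (g : U2C) : (adMatrix g).det = 1 := by
  have key : ∀ M : Matrix (Fin 3) (Fin 3) ℝ,
      ((∑ i, ((M i 0 : ℝ) : ℂ) • pauli i) * (∑ i, ((M i 1 : ℝ) : ℂ) • pauli i) *
        (∑ i, ((M i 2 : ℝ) : ℂ) • pauli i)).trace = 2 * Complex.I * (M.det : ℂ) := by
    intro M
    rw [Matrix.det_fin_three]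
    simp [pauli, Fin.sum_univ_three, Matrix.trace_fin_two]
    ring_nf
  have h := key (adMatrix g)
  rw [← conj_pauli, ← conj_pauli, ← conj_pauli] at h
  have e : (g : Matrix (Fin 2) (Fin 2) ℂ) * pauli 0 * (g : Matrix (Fin 2) (Fin 2) ℂ)ᴴ *
      ((g : Matrix (Fin 2) (Fin 2) ℂ) * pauli 1 * (g : Matrix (Fin 2) (Fin 2) ℂ)ᴴ) *
      ((g : Matrix (Fin 2) (Fin 2) ℂ) * pauli 2 * (g : Matrix (Fin 2) (Fin 2) ℂ)ᴴ) =
      (g : Matrix (Fin 2) (Fin 2) ℂ) * (pauli 0 * pauli 1 * pauli 2) *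
        (g : Matrix (Fin 2) (Fin 2) ℂ)ᴴ := by
    have s : ∀ X : Matrix (Fin 2) (Fin 2) ℂ, (g : Matrix (Fin 2) (Fin 2) ℂ)ᴴ *
        ((g : Matrix (Fin 2) (Fin 2) ℂ) * X) = X := fun X => by
      rw [← Matrix.mul_assoc, U2C_star_mul, Matrix.one_mul]
    simp only [Matrix.mul_assoc, s]
  rw [e, Matrix.trace_mul_comm, ← Matrix.mul_assoc, U2C_star_mul, Matrix.one_mul] at h
  have t : (pauli 0 * pauli 1 * pauli 2).trace = 2 * Complex.I := by
    simp [pauli, Matrix.trace_fin_two]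
    ring
  rw [t] at h
  have h2 : (2 * Complex.I : ℂ) ≠ 0 := by simp
  have : ((adMatrix g).det : ℂ) = 1 := by
    apply mul_left_cancel₀ h2
    rw [← h, mul_one]
  exact_mod_cast this

/-- `π : U₂ → SO₃`, the action by conjugation on traceless hermitian matrices, written in the
Pauli basis. -/
def piHom : U2C →* SO3 where
  toFun g := ⟨adMatrix g, Matrix.mem_specialOrthogonalGroup_iff.2
    ⟨Matrix.mem_orthogonalGroup_iff (Fin 3) ℝ |>.2 (adMatrix_mul_transpose g), adMatrix_det g⟩⟩
  map_one' := Subtype.ext adMatrix_one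
  map_mul' g h := Subtype.ext (adMatrix_mul g h)

/-- `π(𝒢_n)`. -/
def piG (n : ℕ) : Subgroup SO3 := (G n).map piHom

/-- The rotation by the angle `θ` about the `y`-axis. -/
def rotY (θ : ℝ) : SO3 :=
  ⟨!![Real.cos θ, 0, Real.sin θ; 0, 1, 0; -Real.sin θ, 0, Real.cos θ],
    Matrix.mem_specialOrthogonalGroup_iff.2 ⟨(Matrix.mem_orthogonalGroup_iff (Fin 3) ℝ).2 (by
      ext i j
      fin_cases i <;> fin_cases j <;> simp [Matrix.mul_apply, Fin.sum_univ_three] <;>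
        nlinarith [Real.sin_sq_add_cos_sq θ]), by
      simp [Matrix.det_fin_three]
      nlinarith [Real.sin_sq_add_cos_sq θ]⟩⟩

/-- The rotation by the angle `θ` about the `z`-axis. -/
def rotZ (θ : ℝ) : SO3 :=
  ⟨!![Real.cos θ, -Real.sin θ, 0; Real.sin θ, Real.cos θ, 0; 0, 0, 1],
    Matrix.mem_specialOrthogonalGroup_iff.2 ⟨(Matrix.mem_orthogonalGroup_iff (Fin 3) ℝ).2 (by
      ext i j
      fin_cases i <;> fin_cases j <;> simp [Matrix.mul_apply, Fin.sum_univ_three] <;>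
        nlinarith [Real.sin_sq_add_cos_sq θ]), by
      simp [Matrix.det_fin_three]
      nlinarith [Real.sin_sq_add_cos_sq θ]⟩⟩

/-- `G(r, s)`: the subgroup of `SO₃(ℝ)` generated by the rotation of order `r` about the `y`-axis
and the rotation of order `s` about the `z`-axis. -/
def Grot (r s : ℕ) : Subgroup SO3 :=
  Subgroup.closure {rotY (2 * Real.pi / r), rotZ (2 * Real.pi / s)}

/-- The two factors `A`, `B` of an amalgamated product, as a family indexed by `Bool`. -/
def Factor (A B : Type) : Bool → Type
  | false => A
  | true => B

instance (A B : Type) [Group A] [Group B] : ∀ b, Group (Factor A B b)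
  | false => inferInstanceAs (Group A)
  | true => inferInstanceAs (Group B)

/-- The pair of homomorphisms `φ : H → A`, `ψ : H → B` as a family indexed by `Bool`. -/
def factorHom {H A B : Type} [Group H] [Group A] [Group B] (φ : H →* A) (ψ : H →* B) :
    ∀ b, H →* Factor A B b
  | false => φ
  | true => ψ

/-- The amalgamated product `A *_H B` along `φ : H → A` and `ψ : H → B`. -/
abbrev Amalgam {H A B : Type} [Group H] [Group A] [Group B] (φ : H →* A) (ψ : H →* B) : Type :=
  Monoid.PushoutI (factorHom φ ψ)

/-- The action of `D_4`, the symmetry group of the square, on the four vertices of the square,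
labelled cyclically by `0, 1, 2, 3`: the rotation `r i` sends `x` to `x + i` and the reflection
`sr i` sends `x` to `-(x + i)` (modulo `4`). -/
def d4ToS4 : DihedralGroup 4 →* Equiv.Perm (Fin 4) where
  toFun
    | .r i => Equiv.addRight (i : Fin 4)
    | .sr i => (Equiv.addRight (i : Fin 4)).trans (Equiv.neg (Fin 4))
  map_one' := by decide
  map_mul' := by
    rintro (i | i) (j | j) <;> revert i j <;> decide

lemma d4ToS4_injective : Function.Injective d4ToS4 := by
  rintro (i | i) (j | j) <;> revert i j <;> decide

/-- For `n = 4 m`, the homomorphism `ℤ/4 → ℤ/n`, `i ↦ m i`. -/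
def zmodScale (n : ℕ) (h4 : 4 ∣ n) : ZMod 4 →+ ZMod n :=
  ZMod.lift 4 ⟨(zmultiplesHom (ZMod n)) ((n / 4 : ℕ) : ZMod n), by
    simp only [zmultiplesHom_apply]
    rw [zsmul_eq_mul]
    have : ((4 * (n / 4) : ℕ) : ZMod n) = 0 := by rw [Nat.mul_div_cancel' h4]; simp
    simpa using this⟩

/-- The inclusion of `D_4` in `D_n` for `4 ∣ n`: the rotation `r` of order `4` is sent to the
rotation `r ^ (n / 4)` of order `4`, and the reflection `s` to the reflection `s`. -/
def d4ToDn (n : ℕ) (h4 : 4 ∣ n) : DihedralGroup 4 →* DihedralGroup n where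
  toFun
    | .r i => .r (zmodScale n h4 i)
    | .sr i => .sr (zmodScale n h4 i)
  map_one' := by
    change DihedralGroup.r (zmodScale n h4 0) = DihedralGroup.r 0
    rw [map_zero]
  map_mul' := by
    rintro (i | i) (j | j) <;> simp [map_add, map_sub]

lemma zmodScale_injective {n : ℕ} (h4 : 4 ∣ n) (hn : n ≠ 0) :
    Function.Injective (zmodScale n h4) := by
  rw [injective_iff_map_eq_zero]
  intro i hi
  have e : zmodScale n h4 ((i.val : ℤ) : ZMod 4) = ((i.val * (n / 4) : ℕ) : ZMod n) := by
    rw [zmodScale, ZMod.lift_coe]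
    simp
  have hv : ((i.val : ℤ) : ZMod 4) = i := by simp
  rw [hv, hi] at e
  have d : n ∣ i.val * (n / 4) := (ZMod.natCast_eq_zero_iff _ _).1 e.symm
  have hlt : i.val < 4 := ZMod.val_lt i
  obtain ⟨m, rfl⟩ := h4
  have hm : 0 < m := by omega
  rw [Nat.mul_div_cancel_left _ (by norm_num)] at d
  have : 4 ∣ i.val := Nat.dvd_of_mul_dvd_mul_right hm d
  exact (ZMod.val_eq_zero i).1 (Nat.eq_zero_of_dvd_of_lt this hlt)

lemma d4ToDn_injective {n : ℕ} (h4 : 4 ∣ n) (hn : n ≠ 0) :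
    Function.Injective (d4ToDn n h4) := by
  rintro (i | i) (j | j) h
  · exact congrArg _ (zmodScale_injective h4 hn (DihedralGroup.r.inj h))
  · exact absurd h (by simp [d4ToDn])
  · exact absurd h (by simp [d4ToDn])
  · exact congrArg _ (zmodScale_injective h4 hn (DihedralGroup.sr.inj h))

end

end CliffordCyclotomic

/-!
The homomorphism `π` only forgets scalars, because a matrix that commutes with the
Pauli matrices is scalar, so everything reduces to groups of rotations.

The Clifford group maps to rotations with entries in `ℤ[1/2]`. A row of such a matrix is a
representation of `4 ^ k` as a sum of three squares, up to scaling, and descent modulo `4`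
(`two_pow_dvd_of_sum_sq`) shows that the entries are integers. Hence the image lies in `SO₃(ℤ)`,
the rotation group of the cube, which is `S_4` acting on the four diagonals (`cubeHom`) and is
generated by the quarter turns about the `y`- and `z`-axes. As `T_n` maps to the rotation by
`2 π / n` about the `z`-axis, `π(𝒢_n) = G(4, n)` (`piG_eq_Grot`).

The rotations of the cube and the dihedral group `D_n` about the `z`-axis agree on `D_4` and
generate `G(4, n)`, which gives a surjection `amalgamHom` from `S_4 *_{D_4} D_n` onto `G(4, n)`. Its
injectivity is a ping-pong argument for an extension to `ℂ` of the `2`-adic absolute value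
(`exists_valuationSubring_two_lt_one`). A root of unity congruent to `1` modulo `2` is `±1`
(`valuation_two_lt_of_pow_eq_one`), so for an angle `θ` in `(2 π / n) ℤ` but not in `(π / 2) ℤ` one
has `|cos θ| = |sin θ| > 1` (`valuation_cos_sin`). An element of `D_n` outside `D_4` therefore takes
a vector with `|x| ≠ |y|` and `|z| ≤ max |x| |y|` to one with `|x| = |y| > |z|`, and an element of
`S_4` outside `D_4`, being a signed permutation of the coordinates that moves the `z`-axis, takes
the latter kind of vector back to the former. A reduced word with a letter from `S_4` thus moves the
`z`-axis to a vector off that axis, so it is not the identity; the remaining words lie in `D_n`,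
which embeds in `SO₃`.
-/

namespace CliffordCyclotomic

open Matrix Complex

/-! ### A dyadic valuation and roots of unity -/

/-- Since `2` is not invertible in `ℤ`, the ideal `(2)` of `ℤ` is contained in the maximal ideal of
some valuation ring of `ℂ`; its valuation extends the `2`-adic one. -/
lemma exists_valuationSubring_two_lt_one :
    ∃ V : ValuationSubring ℂ, V.valuation (2 : ℂ) < 1 := by
  have hI : Ideal.span {(2 : (⊥ : Subring ℂ))} ≠ ⊤ := by
    rw [Ne, Ideal.span_singleton_eq_top, isUnit_iff_exists_inv]
    rintro ⟨⟨b, hb⟩, h⟩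
    obtain ⟨k, rfl⟩ := Subring.mem_bot.1 hb
    have h' : (2 : ℂ) * (k : ℂ) = 1 := congrArg Subtype.val h
    have h'' : (2 : ℤ) * k = 1 := by exact_mod_cast h'
    omega
  obtain ⟨V, -, hV⟩ := Ideal.image_subset_nonunits_valuationSubring _ hI
  exact ⟨V, V.mem_nonunits_iff.1 (hV ⟨2, Ideal.mem_span_singleton_self _, rfl⟩)⟩

section Valuation

variable {Γ : Type*} [LinearOrderedCommGroupWithZero Γ] (v : Valuation ℂ Γ)

lemma valuation_natCast_le_one (k : ℕ) : v (k : ℂ) ≤ 1 := by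
  induction k with
  | zero => simp
  | succ k ih => simpa using v.map_add_le ih v.map_one.le

lemma valuation_eq_one_of_pow_eq_one {ξ : ℂ} {N : ℕ} (hN : N ≠ 0) (h : ξ ^ N = 1) : v ξ = 1 := by
  have h1 : v ξ ^ N = 1 := by rw [← map_pow, h, map_one]
  exact (pow_eq_one_iff_of_nonneg zero_le hN).1 h1

variable {v} (hv : v 2 < 1)
include hv

/-- A root of unity congruent to `1` modulo `4` is `1`. In odd order, the vanishing sum
`1 + η + ⋯ + η ^ (N - 1)` would be congruent to the unit `N`; in even order, `-1` is not congruent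
to `1` modulo `4`. -/
lemma eq_one_of_pow_eq_one_of_valuation_le {η : ℂ} {N : ℕ} (hN : N ≠ 0) (h : η ^ N = 1)
    (hη : v (η - 1) ≤ v 4) : η = 1 := by
  have h4 : v 4 = v 2 * v 2 := by rw [← map_mul]; norm_num
  have h20 : v 2 ≠ 0 := (Valuation.ne_zero_iff v).2 two_ne_zero
  have h42 : v 4 < v 2 := by
    rw [h4]
    exact mul_lt_of_lt_one_left (zero_lt_iff.2 h20) hv
  have hpow : ∀ k : ℕ, v (η ^ k - 1) ≤ v 4 := by
    intro k
    rw [← geom_sum_mul, map_mul]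
    refine (mul_le_of_le_one_left' ?_).trans hη
    refine v.map_sum_le fun i _ => ?_
    rw [map_pow, valuation_eq_one_of_pow_eq_one v hN h, one_pow]
  induction N using Nat.strong_induction_on with
  | _ N ih =>
    rcases Nat.even_or_odd' N with ⟨k, rfl | rfl⟩
    · have hk : k ≠ 0 := by omega
      refine ih k (by omega) hk ?_
      rcases sq_eq_one_iff.1 (show (η ^ k) ^ 2 = 1 by rw [← pow_mul, mul_comm, h])
        with h1 | h1
      · exact h1
      · have := hpow k
        rw [h1, show (-1 - 1 : ℂ) = -2 by norm_num, Valuation.map_neg] at this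
        exact absurd this (not_le.2 h42)
    · by_contra hne
      have hs : ∑ i ∈ Finset.range (2 * k + 1), η ^ i = 0 := by
        have := geom_sum_mul η (2 * k + 1)
        rw [h, sub_self] at this
        exact (mul_eq_zero.1 this).resolve_right (sub_ne_zero.2 hne)
      have hd : v (∑ i ∈ Finset.range (2 * k + 1), (η ^ i - 1)) ≤ v 4 :=
        v.map_sum_le fun i _ => hpow i
      rw [Finset.sum_sub_distrib, hs] at hd
      have hd' : v ((2 : ℂ) * k + 1) < 1 := by
        refine lt_of_le_of_lt ?_ (h42.trans hv)
        rw [← Valuation.map_neg]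
        simpa using hd
      have h2k : v ((2 : ℂ) * k) < 1 := by
        rw [map_mul]
        exact mul_lt_one_of_lt_of_le hv (valuation_natCast_le_one v k)
      have := v.map_sub_lt hd' h2k
      simp at this

/-- The only roots of unity congruent to `1` modulo `2` are `1` and `-1`. -/
lemma valuation_two_lt_of_pow_eq_one {ξ : ℂ} {N : ℕ} (hN : N ≠ 0) (h : ξ ^ N = 1)
    (h2 : ξ ^ 2 ≠ 1) : v 2 < v (ξ - 1) := by
  by_contra hle
  rw [not_lt] at hle
  refine h2 (eq_one_of_pow_eq_one_of_valuation_le hv hN ?_ ?_)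
  · rw [← pow_mul, mul_comm, pow_mul, h, one_pow]
  · have h4 : v 4 = v 2 * v 2 := by rw [← map_mul]; norm_num
    rw [h4, show ξ ^ 2 - 1 = (ξ - 1) * ((ξ - 1) + 2) by ring, map_mul]
    exact mul_le_mul' hle (v.map_add_le hle le_rfl)

/-- If `exp (i θ)` is a root of unity of order not dividing `4`, then `cos θ` and `sin θ` have the
same dyadic absolute value, and it exceeds `1`. -/
lemma valuation_cos_sin {θ : ℝ} {N : ℕ} (hN : N ≠ 0)
    (h : Complex.exp (θ * Complex.I) ^ N = 1) (h4 : Complex.exp (θ * Complex.I) ^ 4 ≠ 1) :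
    1 < v (Real.cos θ : ℂ) ∧ v (Real.sin θ : ℂ) = v (Real.cos θ : ℂ) := by
  set z := Complex.exp (θ * Complex.I) with hz
  have hz1 : v z = 1 := valuation_eq_one_of_pow_eq_one v hN h
  have hI : v Complex.I = 1 := valuation_eq_one_of_pow_eq_one v four_ne_zero Complex.I_pow_four
  have h20 : v 2 ≠ 0 := (Valuation.ne_zero_iff v).2 two_ne_zero
  have hzc : z = Real.cos θ + Real.sin θ * Complex.I := by
    rw [hz, Complex.exp_mul_I]; simp
  have hcs : (Real.cos θ : ℂ) ^ 2 + (Real.sin θ : ℂ) ^ 2 = 1 := by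
    exact_mod_cast Real.cos_sq_add_sin_sq θ
  have hI2 := Complex.I_sq
  have hzN : (z ^ 2) ^ N = 1 := by rw [← pow_mul, mul_comm, pow_mul, h, one_pow]
  have hc : z ^ 2 + 1 = 2 * Real.cos θ * z := by
    rw [hzc]
    linear_combination (-1 : ℂ) * hcs + (Real.sin θ : ℂ) ^ 2 * hI2
  have hs : z ^ 2 - 1 = 2 * Real.sin θ * (Complex.I * z) := by
    rw [hzc]
    linear_combination (1 : ℂ) * hcs - (Real.sin θ : ℂ) ^ 2 * hI2
  have hvs : v (z ^ 2 - 1) = v 2 * v (Real.sin θ : ℂ) := by rw [hs]; simp [hz1, hI]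
  have hvc : v (z ^ 2 + 1) = v 2 * v (Real.cos θ : ℂ) := by rw [hc]; simp [hz1]
  have key : v 2 < v (z ^ 2 - 1) :=
    valuation_two_lt_of_pow_eq_one hv hN hzN (by rw [← pow_mul]; exact h4)
  have e : v (z ^ 2 + 1) = v (z ^ 2 - 1) := by
    rw [show z ^ 2 + 1 = (z ^ 2 - 1) + 2 by ring]
    exact v.map_add_eq_of_lt_left key
  refine ⟨?_, ?_⟩
  · rw [← e, hvc] at key
    by_contra hle
    exact absurd key (not_lt.2 (mul_le_of_le_one_right' (not_lt.1 hle)))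
  · rw [hvc, hvs] at e
    exact (mul_left_cancel₀ h20 e).symm

end Valuation

/-! ### The rotation group of the cube -/

/-- Alternate vertices of the cube with vertices `(±1, ±1, ±1)`, one on each of its four diagonals.
The rotation by a quarter turn about the `z`-axis permutes the diagonals cyclically in this order
(it sends `tetra k` to `-tetra (k + 1)`). -/
def tetra : Fin 4 → Fin 3 → ℤ := ![![1, 1, 1], ![1, -1, -1], ![-1, -1, 1], ![-1, 1, -1]]

/-- The matrix of the rotation of the cube that permutes its four diagonals by `σ`. The linear map
that permutes the vertices `tetra k` of the tetrahedron by `σ` has determinant `sign σ`, and it is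
multiplied by `sign σ` to obtain a rotation; the division by `4` is exact because
`∑ k, tetra k i * tetra k j` is `4` if `i = j` and `0` otherwise. -/
def cubeInt (σ : Equiv.Perm (Fin 4)) : Matrix (Fin 3) (Fin 3) ℤ :=
  Matrix.of fun i j => (Equiv.Perm.sign σ : ℤ) * ((∑ k, tetra (σ k) i * tetra k j) / 4)

lemma cubeInt_one : cubeInt 1 = 1 := by decide +kernel

set_option maxRecDepth 10000 in
lemma cubeInt_mul : ∀ σ τ, cubeInt (σ * τ) = cubeInt σ * cubeInt τ := by decide +kernel

lemma cubeInt_mul_transpose : ∀ σ, cubeInt σ * (cubeInt σ)ᵀ = 1 := by decide +kernel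

lemma cubeInt_det : ∀ σ, (cubeInt σ).det = 1 := by
  simp only [Matrix.det_fin_three]
  decide +kernel

/-- The six integral unit vectors of `ℤ³`. -/
def unitVec : Fin 3 × Bool → Fin 3 → ℤ := fun a => Pi.single a.1 (if a.2 then 1 else -1)

/-- An integral matrix of determinant `1` whose rows are unit vectors is a rotation of the cube. -/
lemma exists_cubeInt_eq_of_unitVec : ∀ a b c : Fin 3 × Bool,
    (Matrix.of ![unitVec a, unitVec b, unitVec c]).det = 1 →
      ∃ σ, cubeInt σ = Matrix.of ![unitVec a, unitVec b, unitVec c] := by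
  simp only [Matrix.det_fin_three]
  decide +kernel

/-- A rotation of the cube that does not stabilize the `z`-axis permutes the coordinates, up to
signs, by a permutation that does not fix the `z`-coordinate. -/
lemma exists_perm_of_notMem_range (σ : Equiv.Perm (Fin 4)) (hσ : σ ∉ d4ToS4.range) :
    ∃ p : Equiv.Perm (Fin 3), p 2 ≠ 2 ∧
      ∀ i, ∃ b, cubeInt σ i = unitVec (p i, b) := by
  have key : ∀ σ, (∃ i : Fin 4, d4ToS4 (.r i) = σ ∨ d4ToS4 (.sr i) = σ) ∨
      ∃ p : Equiv.Perm (Fin 3), p 2 ≠ 2 ∧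
        ∀ i, ∃ b, cubeInt σ i = unitVec (p i, b) := by
    decide +kernel
  refine (key σ).resolve_left ?_
  rintro ⟨i, h | h⟩ <;> exact hσ ⟨_, h⟩

/-- The rotation of the cube with integral matrix `cubeInt σ`, as a homomorphism on `S_4`. -/
def cubeHom : Equiv.Perm (Fin 4) →* SO3 where
  toFun σ := ⟨(cubeInt σ).map (Int.castRingHom ℝ), Matrix.mem_specialOrthogonalGroup_iff.2
    ⟨(Matrix.mem_orthogonalGroup_iff (Fin 3) ℝ).2 (by
      have := congrArg (fun M => M.map (Int.castRingHom ℝ)) (cubeInt_mul_transpose σ)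
      simp only [Matrix.map_mul, Matrix.transpose_map] at this
      refine this.trans (Matrix.map_one _ (map_zero _) (map_one _))), by
      rw [← RingHom.mapMatrix_apply, ← RingHom.map_det, cubeInt_det, map_one]⟩⟩
  map_one' := Subtype.ext (by simp [cubeInt_one])
  map_mul' σ τ := Subtype.ext (by
    change (cubeInt (σ * τ)).map (Int.castRingHom ℝ) = _
    rw [cubeInt_mul, Matrix.map_mul]
    rfl)

lemma cubeHom_apply (σ : Equiv.Perm (Fin 4)) (i j : Fin 3) :
    (cubeHom σ : Matrix (Fin 3) (Fin 3) ℝ) i j = cubeInt σ i j := rfl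

lemma cubeHom_eq_of_cubeInt_eq {σ : Equiv.Perm (Fin 4)} {g : SO3} {A : Matrix (Fin 3) (Fin 3) ℤ}
    (hσ : cubeInt σ = A) (hg : (g : Matrix (Fin 3) (Fin 3) ℝ) = A.map (Int.castRingHom ℝ)) :
    cubeHom σ = g := by
  subst hσ
  exact Subtype.ext hg.symm

lemma cubeHom_finRotate : cubeHom (finRotate 4) = rotZ (Real.pi / 2) := by
  refine cubeHom_eq_of_cubeInt_eq (A := !![0, -1, 0; 1, 0, 0; 0, 0, 1]) (by decide +kernel) ?_
  ext i j
  fin_cases i <;> fin_cases j <;> simp [rotZ]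

lemma cubeHom_formPerm : cubeHom (List.formPerm [0, 2, 3, 1]) = rotY (Real.pi / 2) := by
  refine cubeHom_eq_of_cubeInt_eq (A := !![0, 0, 1; 0, 1, 0; -1, 0, 0]) (by decide +kernel) ?_
  ext i j
  fin_cases i <;> fin_cases j <;> simp [rotY]

/-- Euler angles: every rotation of the cube is a product of quarter turns about the `z`-, `y`- and
`z`-axes. -/
lemma exists_euler_angles : ∀ σ : Equiv.Perm (Fin 4), ∃ a b c : Fin 4,
    σ = finRotate 4 ^ (a : ℕ) * List.formPerm [0, 2, 3, 1] ^ (b : ℕ) *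
      finRotate 4 ^ (c : ℕ) := by
  decide +kernel

lemma cubeHom_range_le {K : Subgroup SO3} (hy : rotY (Real.pi / 2) ∈ K)
    (hz : rotZ (Real.pi / 2) ∈ K) : cubeHom.range ≤ K := by
  rintro _ ⟨σ, rfl⟩
  obtain ⟨a, b, c, rfl⟩ := exists_euler_angles σ
  simp only [map_mul, map_pow, cubeHom_finRotate, cubeHom_formPerm]
  exact K.mul_mem (K.mul_mem (K.pow_mem hz _) (K.pow_mem hy _)) (K.pow_mem hz _)

lemma exists_unitVec_eq (a : Fin 3 → ℤ) (h : a 0 ^ 2 + a 1 ^ 2 + a 2 ^ 2 = 1) :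
    ∃ s, unitVec s = a := by
  have bound : ∀ x : ℤ, x ^ 2 ≤ 1 → x = -1 ∨ x = 0 ∨ x = 1 := by
    intro x hx
    have := abs_le.1 (sq_le_one_iff_abs_le_one x |>.1 hx)
    omega
  have key : ∀ x y z : Fin 3, ((x : ℤ) - 1) ^ 2 + ((y : ℤ) - 1) ^ 2 + ((z : ℤ) - 1) ^ 2 = 1 →
      ∃ s, unitVec s = ![(x : ℤ) - 1, (y : ℤ) - 1, (z : ℤ) - 1] := by decide +kernel
  have lift : ∀ x : ℤ, x ^ 2 ≤ 1 → ∃ u : Fin 3, x = (u : ℤ) - 1 := by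
    intro x hx
    rcases bound x hx with rfl | rfl | rfl
    exacts [⟨0, by simp⟩, ⟨1, by simp⟩, ⟨2, by simp⟩]
  obtain ⟨x, hx⟩ := lift (a 0) (by nlinarith [sq_nonneg (a 1), sq_nonneg (a 2)])
  obtain ⟨y, hy⟩ := lift (a 1) (by nlinarith [sq_nonneg (a 0), sq_nonneg (a 2)])
  obtain ⟨z, hz⟩ := lift (a 2) (by nlinarith [sq_nonneg (a 0), sq_nonneg (a 1)])
  have ha : a = ![a 0, a 1, a 2] := by ext i; fin_cases i <;> rfl
  rw [ha, hx, hy, hz]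
  exact key x y z (by rw [← hx, ← hy, ← hz]; exact h)

lemma SO3_row_norm (g : SO3) (i : Fin 3) : (g : Matrix (Fin 3) (Fin 3) ℝ) i 0 ^ 2 +
    (g : Matrix (Fin 3) (Fin 3) ℝ) i 1 ^ 2 + (g : Matrix (Fin 3) (Fin 3) ℝ) i 2 ^ 2 = 1 := by
  have h := (Matrix.mem_orthogonalGroup_iff (Fin 3) ℝ).1
    (Matrix.mem_specialOrthogonalGroup_iff.1 g.2).1
  have := congrFun (congrFun h i) i
  simpa [Matrix.mul_apply, Fin.sum_univ_three, Matrix.star_apply, sq] using this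

/-- `SO₃(ℤ)` is the rotation group of the cube. -/
lemma mem_range_cubeHom (g : SO3)
    (hg : ∀ i j, ∃ a : ℤ, (g : Matrix (Fin 3) (Fin 3) ℝ) i j = a) : g ∈ cubeHom.range := by
  choose A hA using hg
  have hgA : (g : Matrix (Fin 3) (Fin 3) ℝ) = (Matrix.of A).map (Int.castRingHom ℝ) := by
    ext i j
    simp [hA]
  have hrow : ∀ i, ∃ s, unitVec s = A i := by
    intro i
    refine exists_unitVec_eq (A i) ?_
    have := SO3_row_norm g i
    simp only [hA] at this
    exact_mod_cast this
  choose s hs using hrow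
  have hAs : Matrix.of A = Matrix.of ![unitVec (s 0), unitVec (s 1), unitVec (s 2)] := by
    ext i j
    fin_cases i <;> simp [hs]
  have hdet : (Matrix.of A).det = 1 := by
    have h := (Matrix.mem_specialOrthogonalGroup_iff.1 g.2).2
    rw [hgA, ← RingHom.mapMatrix_apply, ← RingHom.map_det] at h
    exact_mod_cast (eq_intCast (Int.castRingHom ℝ) _).symm.trans h
  obtain ⟨σ, hσ⟩ := exists_cubeInt_eq_of_unitVec (s 0) (s 1) (s 2) (hAs ▸ hdet)
  exact ⟨σ, cubeHom_eq_of_cubeInt_eq (hσ.trans hAs.symm) hgA⟩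

/-! ### Dihedral groups of rotations -/

lemma rotZ_zero : rotZ 0 = 1 := by
  apply Subtype.ext
  ext i j
  fin_cases i <;> fin_cases j <;> simp [rotZ]

lemma rotZ_mul (a b : ℝ) : rotZ a * rotZ b = rotZ (a + b) := by
  apply Subtype.ext
  change (rotZ a : Matrix (Fin 3) (Fin 3) ℝ) * (rotZ b : Matrix (Fin 3) (Fin 3) ℝ) = rotZ (a + b)
  ext i j
  fin_cases i <;> fin_cases j <;>
    simp [rotZ, Matrix.mul_apply, Fin.sum_univ_three, Real.cos_add, Real.sin_add] <;> ring

/-- Rotations about the `z`-axis, as a homomorphism on angles. -/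
noncomputable def rotZHom : ℝ →+ Additive SO3 where
  toFun θ := Additive.ofMul (rotZ θ)
  map_zero' := congrArg Additive.ofMul rotZ_zero
  map_add' a b := congrArg Additive.ofMul (rotZ_mul a b).symm

lemma rotZ_pow (θ : ℝ) (k : ℕ) : rotZ θ ^ k = rotZ (k * θ) := by
  have := map_nsmul rotZHom k θ
  rw [nsmul_eq_mul] at this
  exact (congrArg Additive.toMul this).symm

lemma rotZ_two_pi : rotZ (2 * Real.pi) = 1 := by
  apply Subtype.ext
  ext i j
  fin_cases i <;> fin_cases j <;> simp [rotZ]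

/-- The cyclic group of rotations about the `z`-axis by multiples of `2 π / n`. -/
noncomputable def cyclicHom (n : ℕ) : ZMod n →+ Additive SO3 :=
  ZMod.lift n ⟨zmultiplesHom (Additive SO3) (rotZHom (2 * Real.pi / n)), by
    rcases eq_or_ne n 0 with rfl | hn
    · simp
    · have : (n : ℝ) ≠ 0 := by exact_mod_cast hn
      rw [zmultiplesHom_apply, natCast_zsmul, ← map_nsmul, nsmul_eq_mul, mul_div_cancel₀ _ this]
      exact congrArg Additive.ofMul rotZ_two_pi⟩

lemma cyclicHom_natCast (n k : ℕ) :
    (cyclicHom n (k : ZMod n)).toMul = rotZ (k * (2 * Real.pi / n)) := by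
  have h : cyclicHom n ((k : ℤ) : ZMod n) = rotZHom (k * (2 * Real.pi / n)) := by
    rw [cyclicHom, ZMod.lift_coe, zmultiplesHom_apply, natCast_zsmul, ← map_nsmul, nsmul_eq_mul]
  rw [Int.cast_natCast] at h
  rw [h]
  rfl

/-- The half turn about the axis spanned by `(1, -1, 0)`, which reverses the `z`-axis. It is the
rotation of the cube corresponding to the reflection `sr 0` of the square. -/
def halfTurn : SO3 := cubeHom (d4ToS4 (.sr 0))

lemma halfTurn_val : (halfTurn : Matrix (Fin 3) (Fin 3) ℝ) = !![0, -1, 0; -1, 0, 0; 0, 0, -1] := by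
  have h : cubeInt (d4ToS4 (.sr 0)) = !![0, -1, 0; -1, 0, 0; 0, 0, -1] := by decide +kernel
  change (cubeInt (d4ToS4 (.sr 0))).map (Int.castRingHom ℝ) = _
  rw [h]
  ext i j
  fin_cases i <;> fin_cases j <;> simp

lemma halfTurn_mul_self : halfTurn * halfTurn = 1 := by
  rw [halfTurn, ← map_mul, ← map_mul, DihedralGroup.sr_mul_sr, sub_self, ← DihedralGroup.one_def,
    map_one, map_one]

lemma rotZ_mul_halfTurn (θ : ℝ) : rotZ θ * halfTurn = halfTurn * rotZ (-θ) := by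
  apply Subtype.ext
  change (rotZ θ : Matrix (Fin 3) (Fin 3) ℝ) * (halfTurn : Matrix (Fin 3) (Fin 3) ℝ) =
    (halfTurn : Matrix (Fin 3) (Fin 3) ℝ) * (rotZ (-θ) : Matrix (Fin 3) (Fin 3) ℝ)
  rw [halfTurn_val]
  ext i j
  fin_cases i <;> fin_cases j <;> simp [rotZ, Matrix.mul_apply, Fin.sum_univ_three]

lemma exists_rotZ_eq_cyclicHom {n : ℕ} (hn : n ≠ 0) (i : ZMod n) :
    ∃ k : ℕ, (k : ZMod n) = i ∧ (cyclicHom n i).toMul = rotZ (k * (2 * Real.pi / n)) := by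
  have : NeZero n := ⟨hn⟩
  exact ⟨i.val, ZMod.natCast_zmod_val i, by
    conv_lhs => rw [← ZMod.natCast_zmod_val i]
    exact cyclicHom_natCast n _⟩

lemma cyclicHom_mul_halfTurn {n : ℕ} (hn : n ≠ 0) (i : ZMod n) :
    (cyclicHom n i).toMul * halfTurn = halfTurn * (cyclicHom n (-i)).toMul := by
  obtain ⟨k, -, h⟩ := exists_rotZ_eq_cyclicHom hn i
  rw [map_neg, toMul_neg, h, rotZ_mul_halfTurn]
  congr 1
  have := map_neg rotZHom (k * (2 * Real.pi / n))
  exact congrArg Additive.toMul this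

/-- The dihedral group of rotations that preserve the `z`-axis and act on the `xy`-plane by the
symmetries of a regular `n`-gon. -/
noncomputable def dihedralHom (n : ℕ) (hn : n ≠ 0) : DihedralGroup n →* SO3 where
  toFun
    | .r i => (cyclicHom n i).toMul
    | .sr i => halfTurn * (cyclicHom n i).toMul
  map_one' := by
    change (cyclicHom n 0).toMul = 1
    rw [map_zero, toMul_zero]
  map_mul' := by
    rintro (i | i) (j | j)
    · simp
    · simp only [DihedralGroup.r_mul_sr]
      rw [← mul_assoc, cyclicHom_mul_halfTurn hn, mul_assoc, ← toMul_add, ← map_add, neg_add_eq_sub]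
    · simp [mul_assoc]
    · simp only [DihedralGroup.sr_mul_sr]
      rw [mul_assoc, ← mul_assoc _ halfTurn, cyclicHom_mul_halfTurn hn, mul_assoc halfTurn,
        ← mul_assoc, halfTurn_mul_self, one_mul, ← toMul_add, ← map_add, neg_add_eq_sub]

lemma dihedralHom_r {n : ℕ} (hn : n ≠ 0) (i : ZMod n) :
    dihedralHom n hn (.r i) = (cyclicHom n i).toMul := rfl

lemma dihedralHom_sr {n : ℕ} (hn : n ≠ 0) (i : ZMod n) :
    dihedralHom n hn (.sr i) = halfTurn * (cyclicHom n i).toMul := rfl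

lemma zeta_pow_eq_exp (n k : ℕ) :
    zeta n ^ k = Complex.exp (((k * (2 * Real.pi / n) : ℝ) : ℂ) * Complex.I) := by
  rw [zeta, ← Complex.exp_nat_mul]
  congr 1
  push_cast
  ring

lemma dihedralHom_injective {n : ℕ} (hn : n ≠ 0) : Function.Injective (dihedralHom n hn) := by
  rw [injective_iff_map_eq_one]
  have hp : IsPrimitiveRoot (zeta n) n := Complex.isPrimitiveRoot_exp n hn
  rintro (i | i) h
  · obtain ⟨k, rfl, hk⟩ := exists_rotZ_eq_cyclicHom hn i
    rw [dihedralHom_r, hk] at h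
    have h' := congrArg (fun g : SO3 => (g : Matrix (Fin 3) (Fin 3) ℝ)) h
    have hc := congrFun (congrFun h' 0) 0
    have hs := congrFun (congrFun h' 1) 0
    simp [rotZ] at hc hs
    have : zeta n ^ k = 1 := by
      rw [zeta_pow_eq_exp, Complex.exp_mul_I, ← Complex.ofReal_cos, ← Complex.ofReal_sin, hc, hs]
      simp
    rw [(ZMod.natCast_eq_zero_iff _ _).2 ((hp.pow_eq_one_iff_dvd k).1 this)]
    rfl
  · obtain ⟨k, rfl, hk⟩ := exists_rotZ_eq_cyclicHom hn i
    rw [dihedralHom_sr, hk] at h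
    have h' : (halfTurn : Matrix (Fin 3) (Fin 3) ℝ) *
      (rotZ (k * (2 * Real.pi / n)) : Matrix (Fin 3) (Fin 3) ℝ) = 1 := congrArg Subtype.val h
    have hz := congrFun (congrFun h' 2) 2
    have hz' : (-1 : ℝ) = 1 := by
      simpa [halfTurn_val, rotZ, Matrix.mul_apply, Fin.sum_univ_three] using hz
    norm_num at hz'

/-- The embeddings of `S_4` and `D_n` in `SO₃` agree on `D_4`. -/
lemma dihedralHom_d4ToDn {n : ℕ} (h4 : 4 ∣ n) (hn : n ≠ 0) (d : DihedralGroup 4) :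
    dihedralHom n hn (d4ToDn n h4 d) = cubeHom (d4ToS4 d) := by
  have key : ∀ i : ZMod 4, (cyclicHom n (zmodScale n h4 i)).toMul = cubeHom (d4ToS4 (.r i)) := by
    intro i
    have e : ∀ i : Fin 4, d4ToS4 (.r i) = finRotate 4 ^ (i : ℕ) := by decide
    have hi : zmodScale n h4 i = ((i.val * (n / 4) : ℕ) : ZMod n) := by
      conv_lhs => rw [← ZMod.natCast_zmod_val i, ← Int.cast_natCast]
      rw [zmodScale, ZMod.lift_coe]
      simp
    rw [hi, cyclicHom_natCast]
    refine Eq.trans ?_ (congrArg cubeHom (e i)).symm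
    rw [map_pow, cubeHom_finRotate, rotZ_pow]
    congr 1
    obtain ⟨m, rfl⟩ := h4
    have hm : (m : ℝ) ≠ 0 := by
      rintro h
      apply hn
      rw [Nat.cast_eq_zero.1 h]
    rw [Nat.mul_div_cancel_left _ (by norm_num)]
    change _ = ((i.val : ℕ) : ℝ) * _
    push_cast
    field_simp
    norm_num
  rcases d with i | i
  · exact key i
  · change halfTurn * (cyclicHom n (zmodScale n h4 i)).toMul = _
    rw [key, halfTurn, ← map_mul, ← map_mul, DihedralGroup.sr_mul_r, zero_add]

/-! ### Ping-pong on dyadic absolute values of coordinates -/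

/-- An induction principle for reduced words in an amalgamated product: a property `Q o x` of
elements `x` together with the index `o` of the leading factor, which passes to longer reduced
words, holds for every element up to left multiplication by the amalgamated subgroup. -/
lemma exists_base_mul_of_reduced {ι H : Type*} {A : ι → Type*} [∀ i, Group (A i)] [Group H]
    {φ : ∀ i, H →* A i} (hφ : ∀ i, Function.Injective (φ i))
    (Q : Option ι → Monoid.PushoutI φ → Prop) (h1 : Q none 1)
    (hcons : ∀ (o : Option ι) (i : ι) (g : A i) (x : Monoid.PushoutI φ), o ≠ some i →
      g ∉ (φ i).range → Q o x → Q (some i) (Monoid.PushoutI.of i g * x))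
    (x : Monoid.PushoutI φ) : ∃ h o y, x = Monoid.PushoutI.base φ h * y ∧ Q o y := by
  classical
  obtain ⟨d⟩ := Monoid.PushoutI.NormalWord.transversal_nonempty φ hφ
  have key : ∀ w : Monoid.PushoutI.NormalWord d,
      ∃ h, Q w.fstIdx (Monoid.PushoutI.base φ h * w.prod) := by
    intro w
    induction w using Monoid.PushoutI.NormalWord.consRecOn with
    | empty =>
      refine ⟨1, ?_⟩
      rw [map_one, one_mul, Monoid.PushoutI.NormalWord.prod_empty]
      exact h1
    | cons i g w hmw hgn hgr hw ih =>
      obtain ⟨h, hQ⟩ := ih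
      refine ⟨1, ?_⟩
      have := hcons _ i (g * φ i h⁻¹) _ hmw
        (fun hg => hgr ((Subgroup.mul_mem_cancel_right _
          (MonoidHom.mem_range.2 ⟨h⁻¹, rfl⟩)).1 hg)) hQ
      convert! this using 1
      rw [map_mul, Monoid.PushoutI.of_apply_eq_base]
      simp [mul_assoc]
    | base h w hw ih =>
      obtain ⟨h', hQ⟩ := ih
      refine ⟨h' * h⁻¹, ?_⟩
      convert! hQ using 1
      simp [Monoid.PushoutI.NormalWord.prod_smul, mul_assoc]
  obtain ⟨h, hQ⟩ := key (Monoid.PushoutI.NormalWord.equiv x)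
  refine ⟨h⁻¹, _, _, ?_, hQ⟩
  have : (Monoid.PushoutI.NormalWord.equiv (d := d) x).prod = x :=
    Monoid.PushoutI.NormalWord.equiv.symm_apply_apply x
  rw [this]
  simp

section PingPong

variable {Γ : Type*} [LinearOrderedCommGroupWithZero Γ] {u : Valuation ℝ Γ}

/-- The unit vector of the `z`-axis. -/
def axisZ : Fin 3 → ℝ := ![0, 0, 1]

/-- A rotation of the cube that moves the `z`-axis takes a vector whose `x`- and `y`-coordinates
have equal absolute value, different from that of its `z`-coordinate, to one whose `x`- and
`y`-coordinates have different absolute values, the larger of them being at least that of the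
`z`-coordinate. -/
lemma cubeHom_pingpong {σ : Equiv.Perm (Fin 4)} (hσ : σ ∉ d4ToS4.range) {x y : Fin 3 → ℝ}
    (hy : y = (cubeHom σ : Matrix (Fin 3) (Fin 3) ℝ) *ᵥ x)
    (h1 : u (x 0) = u (x 1)) (h2 : u (x 2) ≠ u (x 1)) :
    u (y 0) ≠ u (y 1) ∧ u (y 2) ≤ max (u (y 0)) (u (y 1)) := by
  obtain ⟨p, hp, hrow⟩ := exists_perm_of_notMem_range σ hσ
  have hu : ∀ i, u (y i) = u (x (p i)) := by
    intro i
    obtain ⟨b, hb⟩ := hrow i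
    have : y i = (if b then 1 else -1) * x (p i) := by
      rw [hy, Matrix.mulVec, dotProduct]
      simp only [cubeHom_apply, hb, unitVec]
      rw [Finset.sum_eq_single (p i)]
      · cases b <;> simp
      · intro j _ hj
        simp [Pi.single_eq_of_ne hj]
      · simp
    rw [this]
    cases b <;> simp [Valuation.map_neg]
  have hx : ∀ i, i ≠ 2 → u (x i) = u (x 1) := by
    intro i hi
    fin_cases i
    exacts [h1, rfl, absurd rfl hi]
  have hcases : ∀ q : Equiv.Perm (Fin 3), q 2 ≠ 2 → (q 0 = 2 ∧ q 1 ≠ 2) ∨ (q 1 = 2 ∧ q 0 ≠ 2) := by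
    decide
  rw [hu, hu, hu, hx _ hp]
  rcases hcases p hp with ⟨ha, hb⟩ | ⟨ha, hb⟩
  · rw [ha, hx _ hb]
    exact ⟨h2, le_max_right _ _⟩
  · rw [ha, hx _ hb]
    exact ⟨h2.symm, le_max_left _ _⟩

/-- A rotation about the `z`-axis by an angle with `|cos θ| = |sin θ| > 1` takes a vector as
produced by `cubeHom_pingpong` to one whose `x`- and `y`-coordinates have equal absolute value,
larger than that of its `z`-coordinate. -/
lemma rotZ_pingpong {θ : ℝ} (hc : 1 < u (Real.cos θ)) (hs : u (Real.sin θ) = u (Real.cos θ))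
    {x y : Fin 3 → ℝ} (hy : y = (rotZ θ : Matrix (Fin 3) (Fin 3) ℝ) *ᵥ x)
    (h1 : u (x 0) ≠ u (x 1)) (h2 : u (x 2) ≤ max (u (x 0)) (u (x 1))) :
    u (y 0) = u (y 1) ∧ u (y 2) < u (y 1) := by
  have hy0 : y 0 = Real.cos θ * x 0 - Real.sin θ * x 1 := by
    rw [hy]; simp [rotZ, Matrix.mulVec, dotProduct, Fin.sum_univ_three, sub_eq_add_neg]
  have hy1 : y 1 = Real.sin θ * x 0 + Real.cos θ * x 1 := by
    rw [hy]; simp [rotZ, Matrix.mulVec, dotProduct, Fin.sum_univ_three]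
  have hy2 : y 2 = x 2 := by
    rw [hy]; simp [rotZ, Matrix.mulVec, dotProduct, Fin.sum_univ_three]
  have hc0 : u (Real.cos θ) ≠ 0 := (zero_lt_one.trans hc).ne'
  have hne : u (Real.cos θ) * u (x 0) ≠ u (Real.cos θ) * u (x 1) :=
    fun h => h1 (mul_left_cancel₀ hc0 h)
  have e0 : u (y 0) = u (Real.cos θ) * max (u (x 0)) (u (x 1)) := by
    rw [hy0, sub_eq_add_neg, Valuation.map_add_of_distinct_val, Valuation.map_neg, map_mul,
      map_mul, hs, mul_max]
    rwa [Valuation.map_neg, map_mul, map_mul, hs]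
  have e1 : u (y 1) = u (Real.cos θ) * max (u (x 0)) (u (x 1)) := by
    rw [hy1, Valuation.map_add_of_distinct_val, map_mul, map_mul, hs, mul_max]
    rwa [map_mul, map_mul, hs]
  refine ⟨e0.trans e1.symm, ?_⟩
  rw [e1, hy2]
  have hpos : 0 < max (u (x 0)) (u (x 1)) := by
    rw [lt_max_iff]
    by_contra hle
    push Not at hle
    exact h1 ((le_zero_iff.1 hle.1).trans (le_zero_iff.1 hle.2).symm)
  exact h2.trans_lt (lt_mul_of_one_lt_left hpos hc)

lemma halfTurn_mulVec (x : Fin 3 → ℝ) :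
    (halfTurn : Matrix (Fin 3) (Fin 3) ℝ) *ᵥ x = ![-x 1, -x 0, -x 2] := by
  rw [halfTurn_val]
  ext i
  fin_cases i <;> simp [Matrix.mulVec, dotProduct, Fin.sum_univ_three]

lemma rotZ_mulVec_axisZ (θ : ℝ) : (rotZ θ : Matrix (Fin 3) (Fin 3) ℝ) *ᵥ axisZ = axisZ := by
  ext i
  fin_cases i <;> simp [rotZ, axisZ, Matrix.mulVec, dotProduct, Fin.sum_univ_three]

/-- The dihedral group preserves the `z`-axis. -/
lemma dihedralHom_mulVec_axisZ {n : ℕ} (hn : n ≠ 0) (d : DihedralGroup n) :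
    (dihedralHom n hn d : Matrix (Fin 3) (Fin 3) ℝ) *ᵥ axisZ = axisZ ∨
      (dihedralHom n hn d : Matrix (Fin 3) (Fin 3) ℝ) *ᵥ axisZ = -axisZ := by
  rcases d with i | i <;> obtain ⟨k, -, hk⟩ := exists_rotZ_eq_cyclicHom hn i
  · left
    rw [dihedralHom_r, hk, rotZ_mulVec_axisZ]
  · right
    rw [dihedralHom_sr, hk]
    change ((halfTurn : Matrix (Fin 3) (Fin 3) ℝ) * (rotZ _ : Matrix (Fin 3) (Fin 3) ℝ)) *ᵥ
      axisZ = _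
    rw [← Matrix.mulVec_mulVec, rotZ_mulVec_axisZ, halfTurn_mulVec]
    ext i
    fin_cases i <;> simp [axisZ]

lemma natCast_mem_range_zmodScale {n : ℕ} (h4 : 4 ∣ n) (hn : n ≠ 0) {k : ℕ} (h : n ∣ k * 4) :
    ∃ i, zmodScale n h4 i = (k : ZMod n) := by
  obtain ⟨m, rfl⟩ := h4
  obtain ⟨c, hc⟩ := h
  have hk : k = c * m := by
    have : 4 * k = 4 * (c * m) := by rw [mul_comm 4 k, hc]; ring
    omega
  refine ⟨((c : ℤ) : ZMod 4), ?_⟩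
  rw [zmodScale, ZMod.lift_coe, hk]
  simp

/-- The dihedral half of the ping-pong: elements outside the image of `D_4` undo the separation of
the `x`- and `y`-coordinates made by `cubeHom_pingpong`. -/
lemma dihedralHom_pingpong {v : Valuation ℂ Γ} (hv : v 2 < 1)
    (hu : u = v.comap Complex.ofRealHom) {n : ℕ} (h4 : 4 ∣ n) (hn : n ≠ 0) {d : DihedralGroup n}
    (hd : d ∉ (d4ToDn n h4).range) {x y : Fin 3 → ℝ}
    (hy : y = (dihedralHom n hn d : Matrix (Fin 3) (Fin 3) ℝ) *ᵥ x)
    (h1 : u (x 0) ≠ u (x 1)) (h2 : u (x 2) ≤ max (u (x 0)) (u (x 1))) :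
    u (y 0) = u (y 1) ∧ u (y 2) < u (y 1) := by
  have angle : ∀ k : ℕ, (∀ i, zmodScale n h4 i ≠ (k : ZMod n)) →
      1 < u (Real.cos (k * (2 * Real.pi / n))) ∧
        u (Real.sin (k * (2 * Real.pi / n))) = u (Real.cos (k * (2 * Real.pi / n))) := by
    intro k hk
    subst hu
    refine valuation_cos_sin hv hn ?_ ?_ <;> rw [← zeta_pow_eq_exp, ← pow_mul]
    · rw [mul_comm, pow_mul, zeta_pow_self hn, one_pow]
    · intro h
      have hp : IsPrimitiveRoot (zeta n) n := Complex.isPrimitiveRoot_exp n hn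
      obtain ⟨i, hi⟩ := natCast_mem_range_zmodScale h4 hn ((hp.pow_eq_one_iff_dvd _).1 h)
      exact hk i hi
  rcases d with i | i <;> obtain ⟨k, rfl, hk⟩ := exists_rotZ_eq_cyclicHom hn i
  · obtain ⟨hc, hs⟩ := angle k fun i hi => hd ⟨.r i, congrArg DihedralGroup.r hi⟩
    rw [dihedralHom_r, hk] at hy
    exact rotZ_pingpong hc hs hy h1 h2
  · obtain ⟨hc, hs⟩ := angle k fun i hi => hd ⟨.sr i, congrArg DihedralGroup.sr hi⟩
    rw [dihedralHom_sr, hk] at hy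
    obtain ⟨e1, e2⟩ := rotZ_pingpong hc hs rfl h1 h2
    have hy' : y = (halfTurn : Matrix (Fin 3) (Fin 3) ℝ) *ᵥ
        ((rotZ (k * (2 * Real.pi / n)) : Matrix (Fin 3) (Fin 3) ℝ) *ᵥ x) := by
      rw [hy, Matrix.mulVec_mulVec]
      rfl
    rw [halfTurn_mulVec] at hy'
    subst hy'
    simp only [Matrix.cons_val, Valuation.map_neg]
    exact ⟨e1.symm, e2.trans_eq e1.symm⟩

end PingPong

/-! ### The amalgamated product -/

/-- The homomorphism from `S_4 *_{D_4} D_n` to `SO₃` that is the rotation group of the cube on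
`S_4` and the dihedral group about the `z`-axis on `D_n`. -/
noncomputable def amalgamHom (n : ℕ) (h4 : 4 ∣ n) (hn : n ≠ 0) :
    Amalgam d4ToS4 (d4ToDn n h4) →* SO3 :=
  Monoid.PushoutI.lift
    (fun
      | false => cubeHom
      | true => dihedralHom n hn)
    (cubeHom.comp d4ToS4) (by
      rintro (_ | _)
      · rfl
      · exact MonoidHom.ext (dihedralHom_d4ToDn h4 hn))

/-- The canonical map of `S_4` to the amalgamated product. -/
def ofS4 (n : ℕ) (h4 : 4 ∣ n) : Equiv.Perm (Fin 4) →* Amalgam d4ToS4 (d4ToDn n h4) :=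
  Monoid.PushoutI.of (φ := factorHom d4ToS4 (d4ToDn n h4)) false

/-- The canonical map of `D_n` to the amalgamated product. -/
def ofDn (n : ℕ) (h4 : 4 ∣ n) : DihedralGroup n →* Amalgam d4ToS4 (d4ToDn n h4) :=
  Monoid.PushoutI.of (φ := factorHom d4ToS4 (d4ToDn n h4)) true

lemma amalgamHom_ofS4 {n : ℕ} (h4 : 4 ∣ n) (hn : n ≠ 0) (σ : Equiv.Perm (Fin 4)) :
    amalgamHom n h4 hn (ofS4 n h4 σ) = cubeHom σ :=
  Monoid.PushoutI.lift_of (φ := factorHom d4ToS4 (d4ToDn n h4)) _ _ _ (i := false) σ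

lemma amalgamHom_ofDn {n : ℕ} (h4 : 4 ∣ n) (hn : n ≠ 0) (d : DihedralGroup n) :
    amalgamHom n h4 hn (ofDn n h4 d) = dihedralHom n hn d :=
  Monoid.PushoutI.lift_of (φ := factorHom d4ToS4 (d4ToDn n h4)) _ _ _ (i := true) d

lemma base_eq_ofDn {n : ℕ} (h4 : 4 ∣ n) (d : DihedralGroup 4) :
    Monoid.PushoutI.base (factorHom d4ToS4 (d4ToDn n h4)) d = ofDn n h4 (d4ToDn n h4 d) :=
  (Monoid.PushoutI.of_apply_eq_base (factorHom d4ToS4 (d4ToDn n h4)) true d).symm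

/-- No reduced word in which a letter from `S_4` occurs preserves the `z`-axis: its last letter
from `S_4` takes the axis to the `x`- or `y`-axis, and the ping-pong between the two kinds of
letters keeps the image away from the `z`-axis. -/
lemma amalgamHom_injective {n : ℕ} (h4 : 4 ∣ n) (hn : n ≠ 0) :
    Function.Injective (amalgamHom n h4 hn) := by
  obtain ⟨V, hV⟩ := exists_valuationSubring_two_lt_one
  set u := V.valuation.comap Complex.ofRealHom with hu
  set f := amalgamHom n h4 hn with hf
  let vec (x : Amalgam d4ToS4 (d4ToDn n h4)) : Fin 3 → ℝ :=
    (f x : Matrix (Fin 3) (Fin 3) ℝ) *ᵥ axisZ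
  have vec_mul : ∀ x y, vec (x * y) = (f x : Matrix (Fin 3) (Fin 3) ℝ) *ᵥ vec y := by
    intro x y
    simp only [vec, map_mul, Matrix.mulVec_mulVec]
    rfl
  have vec_one : vec 1 = axisZ := by
    simp only [vec, map_one]
    exact Matrix.one_mulVec _
  have step_S4 : ∀ σ x, vec (ofS4 n h4 σ * x) =
      (cubeHom σ : Matrix (Fin 3) (Fin 3) ℝ) *ᵥ vec x := by
    intro σ x
    rw [vec_mul, hf, amalgamHom_ofS4]
  have step_Dn : ∀ d x, vec (ofDn n h4 d * x) =
      (dihedralHom n hn d : Matrix (Fin 3) (Fin 3) ℝ) *ᵥ vec x := by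
    intro d x
    rw [vec_mul, hf, amalgamHom_ofDn]
  have hinj : ∀ b, Function.Injective (factorHom d4ToS4 (d4ToDn n h4) b) := by
    rintro (_ | _)
    exacts [d4ToS4_injective, d4ToDn_injective h4 hn]
  have axis : ∀ z : Fin 3 → ℝ, z = axisZ ∨ z = -axisZ → u (z 0) = u (z 1) ∧ u (z 2) ≠ u (z 1) := by
    rintro z (rfl | rfl) <;> simp [axisZ, Valuation.map_neg]
  have vec_ofDn : ∀ d, vec (ofDn n h4 d) = axisZ ∨ vec (ofDn n h4 d) = -axisZ := by
    intro d
    simp only [vec, hf, amalgamHom_ofDn]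
    exact dihedralHom_mulVec_axisZ hn d
  -- The property of reduced words that the ping-pong preserves, by the factor of the first letter.
  let Q : Option Bool → Amalgam d4ToS4 (d4ToDn n h4) → Prop
    | none, x => x = 1
    | some false, x => u (vec x 0) ≠ u (vec x 1) ∧ u (vec x 2) ≤ max (u (vec x 0)) (u (vec x 1))
    | some true, x => (∃ d, x = ofDn n h4 d) ∨
        (u (vec x 0) = u (vec x 1) ∧ u (vec x 2) < u (vec x 1))
  have word := exists_base_mul_of_reduced hinj Q rfl (by
    rintro (_ | _ | _) (_ | _) g x hne hg hx
    · have hx' := axis (vec x) (.inl (by rw [show x = 1 from hx]; exact vec_one))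
      exact cubeHom_pingpong (σ := g) hg (step_S4 g x) hx'.1 hx'.2
    · exact .inl ⟨g, by rw [show x = 1 from hx, mul_one]; rfl⟩
    · exact absurd rfl hne
    · exact .inr (dihedralHom_pingpong hV hu h4 hn (d := g) hg (step_Dn g x) hx.1 hx.2)
    · have hx' : u (vec x 0) = u (vec x 1) ∧ u (vec x 2) ≠ u (vec x 1) := by
        rcases hx with ⟨d, rfl⟩ | hx
        · exact axis _ (vec_ofDn d)
        · exact ⟨hx.1, hx.2.ne⟩
      exact cubeHom_pingpong (σ := g) hg (step_S4 g x) hx'.1 hx'.2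
    · exact absurd rfl hne)
  rw [injective_iff_map_eq_one]
  intro x hx
  obtain ⟨d, o, y, rfl, hQ⟩ := word x
  rw [base_eq_ofDn] at hx ⊢
  have hDn : ∀ d', y = ofDn n h4 d' → ofDn n h4 (d4ToDn n h4 d) * y = 1 := by
    rintro d' rfl
    rw [← map_mul] at hx ⊢
    rw [hf, amalgamHom_ofDn] at hx
    rw [(injective_iff_map_eq_one _).1 (dihedralHom_injective hn) _ hx, map_one]
  -- The amalgamated subgroup preserves the `z`-axis, so `y` does.
  have hy : vec y = axisZ ∨ vec y = -axisZ := by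
    have e : y = ofDn n h4 (d4ToDn n h4 d)⁻¹ * (ofDn n h4 (d4ToDn n h4 d) * y) := by simp
    have : vec y = vec (ofDn n h4 (d4ToDn n h4 d)⁻¹) := by
      simp only [vec]
      rw [e, map_mul f, hx, mul_one]
    rw [this]
    exact vec_ofDn _
  rcases o with _ | _ | _
  · exact hDn 1 (by rw [map_one]; exact hQ)
  · exact absurd (axis _ hy).1 hQ.1
  · rcases hQ with ⟨d', hd'⟩ | hQ
    · exact hDn d' hd'
    · exfalso
      have h1 : u (vec y 1) = 0 := by
        rcases hy with h | h <;> simp [h, axisZ]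
      exact absurd hQ.2 (by rw [h1]; exact not_lt_zero)

lemma rotZ_two_pi_div_mem_Grot (n : ℕ) : rotZ (2 * Real.pi / n) ∈ Grot 4 n :=
  Subgroup.subset_closure (by simp)

lemma rotY_pi_div_two_mem_Grot (n : ℕ) : rotY (Real.pi / 2) ∈ Grot 4 n := by
  have : rotY (Real.pi / 2) = rotY (2 * Real.pi / (4 : ℕ)) := by
    congr 1
    push_cast
    ring
  rw [this]
  exact Subgroup.subset_closure (by simp)

lemma rotZ_pi_div_two_eq {n : ℕ} (h4 : 4 ∣ n) (hn : n ≠ 0) :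
    rotZ (Real.pi / 2) = rotZ (2 * Real.pi / n) ^ (n / 4) := by
  rw [rotZ_pow]
  congr 1
  obtain ⟨m, rfl⟩ := h4
  have hm : (m : ℝ) ≠ 0 := by
    intro h
    apply hn
    rw [Nat.cast_eq_zero.1 h]
  rw [Nat.mul_div_cancel_left _ (by norm_num)]
  push_cast
  field_simp
  norm_num

lemma cubeHom_range_le_Grot {n : ℕ} (h4 : 4 ∣ n) (hn : n ≠ 0) : cubeHom.range ≤ Grot 4 n := by
  refine cubeHom_range_le (rotY_pi_div_two_mem_Grot n) ?_
  rw [rotZ_pi_div_two_eq h4 hn]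
  exact (Grot 4 n).pow_mem (rotZ_two_pi_div_mem_Grot n) _

lemma amalgamHom_range {n : ℕ} (h4 : 4 ∣ n) (hn : n ≠ 0) :
    (amalgamHom n h4 hn).range = Grot 4 n := by
  have hS := cubeHom_range_le_Grot h4 hn
  apply le_antisymm
  · rintro _ ⟨x, rfl⟩
    have hD : ∀ d, dihedralHom n hn d ∈ Grot 4 n := by
      have hc : ∀ i, (cyclicHom n i).toMul ∈ Grot 4 n := by
        intro i
        obtain ⟨k, -, hk⟩ := exists_rotZ_eq_cyclicHom hn i
        rw [hk, ← rotZ_pow]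
        exact (Grot 4 n).pow_mem (rotZ_two_pi_div_mem_Grot n) _
      rintro (i | i)
      · exact hc i
      · exact (Grot 4 n).mul_mem (hS ⟨_, rfl⟩) (hc i)
    induction x using Monoid.PushoutI.induction_on with
    | of b g =>
      rcases b with _ | _
      · exact (amalgamHom_ofS4 h4 hn g).symm ▸ hS ⟨_, rfl⟩
      · exact (amalgamHom_ofDn h4 hn g).symm ▸ hD g
    | base h =>
      rw [base_eq_ofDn, amalgamHom_ofDn]
      exact hD _
    | mul x y hx hy =>
      rw [map_mul]
      exact (Grot 4 n).mul_mem hx hy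
  · refine (Subgroup.closure_le _).2 ?_
    rintro _ (rfl | rfl)
    · refine ⟨ofS4 n h4 (List.formPerm [0, 2, 3, 1]), ?_⟩
      rw [amalgamHom_ofS4, cubeHom_formPerm]
      congr 1
      push_cast
      ring
    · refine ⟨ofDn n h4 (.r (1 : ℕ)), ?_⟩
      rw [amalgamHom_ofDn, dihedralHom_r, cyclicHom_natCast, Nat.cast_one, one_mul]

/-! ### Integrality of the Clifford group -/

/-- The ring `ℤ[1/2]` of dyadic rationals, as a subring of `ℝ`. -/
def dyadic : Subring ℝ where
  carrier := {x | ∃ (k : ℕ) (a : ℤ), 2 ^ k * x = a}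
  one_mem' := ⟨0, 1, by simp⟩
  zero_mem' := ⟨0, 0, by simp⟩
  neg_mem' := by
    rintro x ⟨k, a, h⟩
    exact ⟨k, -a, by push_cast; linarith⟩
  mul_mem' := by
    rintro x y ⟨k, a, h⟩ ⟨l, b, h'⟩
    exact ⟨k + l, a * b, by push_cast; rw [← h, ← h']; ring⟩
  add_mem' := by
    rintro x y ⟨k, a, h⟩ ⟨l, b, h'⟩
    exact ⟨k + l, 2 ^ l * a + 2 ^ k * b, by push_cast; rw [← h, ← h']; ring⟩

lemma half_mem_dyadic : (1 / 2 : ℝ) ∈ dyadic := ⟨1, 1, by norm_num⟩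

/-- The ring `ℤ[i, 1/2]`, described by real and imaginary parts. -/
def gaussDyadic : Subring ℂ where
  carrier := {z | z.re ∈ dyadic ∧ z.im ∈ dyadic}
  one_mem' := ⟨dyadic.one_mem, dyadic.zero_mem⟩
  zero_mem' := ⟨dyadic.zero_mem, dyadic.zero_mem⟩
  neg_mem' := fun ⟨h, h'⟩ => ⟨dyadic.neg_mem h, dyadic.neg_mem h'⟩
  mul_mem' := fun ⟨h, h'⟩ ⟨k, k'⟩ =>
    ⟨dyadic.sub_mem (dyadic.mul_mem h k) (dyadic.mul_mem h' k'),
      dyadic.add_mem (dyadic.mul_mem h k') (dyadic.mul_mem h' k)⟩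
  add_mem' := fun ⟨h, h'⟩ ⟨k, k'⟩ => ⟨dyadic.add_mem h k, dyadic.add_mem h' k'⟩

lemma zeta_four : zeta 4 = Complex.I := by
  rw [zeta, show (2 * Real.pi * Complex.I / (4 : ℕ) : ℂ) = Real.pi / 2 * Complex.I by
    push_cast; ring]
  exact Complex.exp_pi_div_two_mul_I

lemma I_mem_gaussDyadic : Complex.I ∈ gaussDyadic :=
  ⟨by simp [dyadic.zero_mem], by simp [dyadic.one_mem]⟩

lemma half_mem_gaussDyadic : (1 / 2 : ℂ) ∈ gaussDyadic := by
  have h : (1 / 2 : ℂ) = ((1 / 2 : ℝ) : ℂ) := by push_cast; rfl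
  rw [h]
  exact ⟨by simpa using half_mem_dyadic, by simp [dyadic.zero_mem]⟩

lemma R_four_le_gaussDyadic : R 4 ≤ gaussDyadic := by
  refine Subring.closure_le.2 ?_
  rintro x (rfl | rfl)
  · rw [zeta_four]
    exact I_mem_gaussDyadic
  · exact half_mem_gaussDyadic

lemma star_mem_gaussDyadic {z : ℂ} (hz : z ∈ gaussDyadic) : star z ∈ gaussDyadic :=
  ⟨hz.1, dyadic.neg_mem hz.2⟩

lemma pauli_mem_gaussDyadic (i : Fin 3) (a b : Fin 2) : pauli i a b ∈ gaussDyadic := by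
  have h0 := gaussDyadic.zero_mem
  have h1 := gaussDyadic.one_mem
  have hI := I_mem_gaussDyadic
  have h1' := gaussDyadic.neg_mem h1
  have hI' := gaussDyadic.neg_mem hI
  fin_cases i <;> fin_cases a <;> fin_cases b <;> assumption

lemma piHom_mem_dyadic {g : U2C} (hg : g ∈ clifford) (i j : Fin 3) :
    (piHom g : Matrix (Fin 3) (Fin 3) ℝ) i j ∈ dyadic := by
  have hmul : ∀ A B : Matrix (Fin 2) (Fin 2) ℂ, (∀ a b, A a b ∈ gaussDyadic) →
      (∀ a b, B a b ∈ gaussDyadic) → ∀ a b, (A * B) a b ∈ gaussDyadic := by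
    intro A B hA hB a b
    rw [Matrix.mul_apply]
    exact gaussDyadic.sum_mem fun k _ => gaussDyadic.mul_mem (hA a k) (hB k b)
  have hgR : ∀ a b, (g : Matrix (Fin 2) (Fin 2) ℂ) a b ∈ gaussDyadic :=
    fun a b => R_four_le_gaussDyadic (hg.1 a b)
  have hall := hmul _ _ (pauli_mem_gaussDyadic i)
    (hmul _ _ (hmul _ _ hgR (pauli_mem_gaussDyadic j))
      fun a b => star_mem_gaussDyadic (hgR b a) : ∀ a b,
        ((g : Matrix (Fin 2) (Fin 2) ℂ) * pauli j * (g : Matrix (Fin 2) (Fin 2) ℂ)ᴴ) a b ∈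
          gaussDyadic)
  change ((pauli i * ((g : Matrix (Fin 2) (Fin 2) ℂ) * pauli j *
    (g : Matrix (Fin 2) (Fin 2) ℂ)ᴴ)).trace / 2).re ∈ dyadic
  rw [Matrix.trace_fin_two, div_eq_mul_one_div]
  exact (gaussDyadic.mul_mem (gaussDyadic.add_mem (hall 0 0) (hall 1 1)) half_mem_gaussDyadic).1

/-- If a sum of three integral squares is divisible by `4`, all three integers are even; so a
representation of `4 ^ k` as a sum of three squares is `2 ^ k` times a representation of `1`. -/
lemma two_pow_dvd_of_sum_sq (k : ℕ) : ∀ a b c : ℤ, a ^ 2 + b ^ 2 + c ^ 2 = 4 ^ k → 2 ^ k ∣ a := by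
  induction k with
  | zero => simp
  | succ k ih =>
    intro a b c h
    have h4 : (4 : ℤ) ∣ a ^ 2 + b ^ 2 + c ^ 2 := by rw [h, pow_succ]; exact dvd_mul_left _ _
    have par : ∀ x : ℤ, ∃ y, x = 2 * y ∨ x = 2 * y + 1 := fun x => ⟨x / 2, by omega⟩
    obtain ⟨x, hx⟩ := par a
    obtain ⟨y, hy⟩ := par b
    obtain ⟨z, hz⟩ := par c
    have hall : a = 2 * x ∧ b = 2 * y ∧ c = 2 * z := by
      rcases hx with rfl | rfl <;> rcases hy with rfl | rfl <;> rcases hz with rfl | rfl <;>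
        ring_nf at h4 <;> omega
    obtain ⟨rfl, rfl, rfl⟩ := hall
    rw [pow_succ, mul_comm]
    refine mul_dvd_mul_left 2 (ih x y z ?_)
    rw [pow_succ 4 k] at h
    linarith

lemma exists_int_eq_of_dyadic {x y z : ℝ} (hx : x ∈ dyadic) (hy : y ∈ dyadic) (hz : z ∈ dyadic)
    (h : x ^ 2 + y ^ 2 + z ^ 2 = 1) : ∃ a : ℤ, x = a := by
  obtain ⟨k, a, ha⟩ := hx
  obtain ⟨l, b, hb⟩ := hy
  obtain ⟨m, c, hc⟩ := hz
  have hsum : (2 ^ (l + m) * a) ^ 2 + (2 ^ (k + m) * b) ^ 2 + (2 ^ (k + l) * c) ^ 2 =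
      (4 : ℤ) ^ (k + l + m) := by
    have : ((2 : ℝ) ^ (l + m) * a) ^ 2 + (2 ^ (k + m) * b) ^ 2 + (2 ^ (k + l) * c) ^ 2 =
        4 ^ (k + l + m) := by
      rw [← ha, ← hb, ← hc, show (4 : ℝ) = 2 ^ 2 by norm_num, ← pow_mul]
      linear_combination (2 : ℝ) ^ (2 * (k + l + m)) * h
    exact_mod_cast this
  obtain ⟨t, ht⟩ := two_pow_dvd_of_sum_sq _ _ _ _ hsum
  refine ⟨t, ?_⟩
  have ht' : (2 : ℝ) ^ (l + m) * a = 2 ^ (k + l + m) * t := by exact_mod_cast ht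
  rw [← ha] at ht'
  have h2 : (2 : ℝ) ^ (k + l + m) ≠ 0 := by positivity
  apply mul_left_cancel₀ h2
  rw [← ht']
  ring

/-- The Clifford group acts by rotations of the cube. -/
lemma piHom_clifford_mem {g : U2C} (hg : g ∈ clifford) : piHom g ∈ cubeHom.range := by
  refine mem_range_cubeHom _ fun i j => ?_
  have hd := piHom_mem_dyadic hg i
  have hn := SO3_row_norm (piHom g) i
  have h0 := exists_int_eq_of_dyadic (hd 0) (hd 1) (hd 2) hn
  have h1 := exists_int_eq_of_dyadic (hd 1) (hd 0) (hd 2) (by linarith)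
  have h2 := exists_int_eq_of_dyadic (hd 2) (hd 0) (hd 1) (by linarith)
  fin_cases j
  exacts [h0, h1, h2]

/-! ### The Clifford-cyclotomic group as a group of rotations -/

lemma conjTranspose_fin_two (a b c d : ℂ) :
    !![a, b; c, d]ᴴ = !![star a, star c; star b, star d] := by
  ext i j
  fin_cases i <;> fin_cases j <;> rfl

lemma star_half_one_add_I : star ((1 + Complex.I) / 2) = (1 - Complex.I) / 2 := by
  rw [Complex.star_def, map_div₀, map_add, map_one, Complex.conj_I, map_ofNat, sub_eq_add_neg]

/-- The element `(1 + i) / 2 • !![1, -1; 1, 1]` of the Clifford group, over the quarter turn about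
the `y`-axis. -/
noncomputable def quarterY : U2C :=
  ⟨!![(1 + Complex.I) / 2, -((1 + Complex.I) / 2); (1 + Complex.I) / 2, (1 + Complex.I) / 2], by
    rw [Matrix.mem_unitaryGroup_iff, Matrix.star_eq_conjTranspose, conjTranspose_fin_two, star_neg,
      star_half_one_add_I, Matrix.mul_fin_two, Matrix.one_fin_two]
    have := Complex.I_sq
    congr 1
    ext i j
    fin_cases i <;> fin_cases j <;> simp <;> linear_combination (-1 / 2 : ℂ) * this⟩

lemma quarterY_mem : quarterY ∈ clifford := by
  have h2 : (1 / 2 : ℂ) ∈ R 4 := Subring.subset_closure (by simp)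
  have hI : Complex.I ∈ R 4 := by
    rw [← zeta_four]
    exact Subring.subset_closure (by simp)
  have hp : (1 + Complex.I) / 2 ∈ R 4 := by
    rw [div_eq_mul_one_div]
    exact (R 4).mul_mem ((R 4).add_mem (R 4).one_mem hI) h2
  have hm : (1 - Complex.I) / 2 ∈ R 4 := by
    rw [div_eq_mul_one_div]
    exact (R 4).mul_mem ((R 4).sub_mem (R 4).one_mem hI) h2
  have hp' := (R 4).neg_mem hp
  have hm' := (R 4).neg_mem hm
  have hinv : ((quarterY⁻¹ : U2C) : Matrix (Fin 2) (Fin 2) ℂ) =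
      !![(1 - Complex.I) / 2, (1 - Complex.I) / 2;
        -((1 - Complex.I) / 2), (1 - Complex.I) / 2] := by
    change (quarterY : Matrix (Fin 2) (Fin 2) ℂ)ᴴ = _
    rw [quarterY, conjTranspose_fin_two, star_neg, star_half_one_add_I]
  constructor <;> intro i j
  · fin_cases i <;> fin_cases j <;> assumption
  · rw [hinv]
    fin_cases i <;> fin_cases j <;> assumption

lemma piHom_quarterY : piHom quarterY = rotY (Real.pi / 2) := by
  apply Subtype.ext
  ext i j
  change ((pauli i * ((quarterY : Matrix (Fin 2) (Fin 2) ℂ) * pauli j *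
    (quarterY : Matrix (Fin 2) (Fin 2) ℂ)ᴴ)).trace / 2).re = _
  rw [quarterY, conjTranspose_fin_two, star_neg, star_half_one_add_I]
  fin_cases i <;> fin_cases j <;>
    norm_num [rotY, pauli, Matrix.trace_fin_two]

lemma zeta_eq_exp (n : ℕ) :
    zeta n = Complex.exp (((2 * Real.pi / n : ℝ) : ℂ) * Complex.I) := by
  simpa using zeta_pow_eq_exp n 1

lemma zeta_re (n : ℕ) : (zeta n).re = Real.cos (2 * Real.pi / n) := by
  rw [zeta_eq_exp, Complex.exp_ofReal_mul_I_re]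

lemma zeta_im (n : ℕ) : (zeta n).im = Real.sin (2 * Real.pi / n) := by
  rw [zeta_eq_exp, Complex.exp_ofReal_mul_I_im]

lemma piHom_T (n : ℕ) : piHom (T n) = rotZ (2 * Real.pi / n) := by
  apply Subtype.ext
  ext i j
  change ((pauli i * ((T n : Matrix (Fin 2) (Fin 2) ℂ) * pauli j *
    (T n : Matrix (Fin 2) (Fin 2) ℂ)ᴴ)).trace / 2).re = _
  rw [T, conjTranspose_fin_two]
  have hcs := Real.cos_sq_add_sin_sq (2 * Real.pi / n)
  fin_cases i <;> fin_cases j <;>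
    simp [rotZ, pauli, Matrix.trace_fin_two, zeta_re, zeta_im]
  linarith

lemma piG_eq_Grot {n : ℕ} (h4 : 4 ∣ n) (hn : n ≠ 0) : piG n = Grot 4 n := by
  apply le_antisymm
  · rw [piG, Subgroup.map_le_iff_le_comap]
    refine (Subgroup.closure_le _).2 (Set.union_subset ?_ ?_)
    · exact fun g hg => cubeHom_range_le_Grot h4 hn (piHom_clifford_mem hg)
    · rintro _ rfl
      change piHom (T n) ∈ Grot 4 n
      rw [piHom_T]
      exact rotZ_two_pi_div_mem_Grot n
  · refine (Subgroup.closure_le _).2 ?_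
    rintro _ (rfl | rfl)
    · refine ⟨quarterY, Subgroup.subset_closure (.inl quarterY_mem), ?_⟩
      rw [piHom_quarterY]
      congr 1
      push_cast
      ring
    · exact ⟨T n, Subgroup.subset_closure (.inr rfl), piHom_T n⟩

lemma two_mul_cos_mem_Rplus (n : ℕ) (k : ℕ) :
    2 * Real.cos (k * (2 * Real.pi / n)) ∈ Rplus n := by
  have h1 : 2 * Real.cos (2 * Real.pi / n) ∈ Rplus n := by
    rw [← zeta_re]
    exact Subring.subset_closure (by simp)
  induction k using Nat.twoStepInduction with
  | zero => simp
  | one => simpa using h1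
  | more k ih ih' =>
    have e : 2 * Real.cos ((k + 2 : ℕ) * (2 * Real.pi / n)) =
        2 * Real.cos (2 * Real.pi / n) * (2 * Real.cos ((k + 1 : ℕ) * (2 * Real.pi / n))) -
          2 * Real.cos (k * (2 * Real.pi / n)) := by
      set t := 2 * Real.pi / n
      have e1 : ((k + 2 : ℕ) : ℝ) * t = (k + 1 : ℕ) * t + t := by push_cast; ring
      have e2 : (k : ℝ) * t = (k + 1 : ℕ) * t - t := by push_cast; ring
      rw [e1, e2, Real.cos_add, Real.cos_sub]
      ring
    rw [e]
    exact (Rplus n).sub_mem ((Rplus n).mul_mem h1 ih') ih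

/-- The sine of `2 π / n` is the cosine of `(n / 4 - 1) * (2 π / n)`, so it lies in `R_n⁺`. -/
lemma Grot_le_SO3R {n : ℕ} (h4 : 4 ∣ n) (hn : n ≠ 0) : Grot 4 n ≤ SO3R (Rplus n) := by
  have h0 := (Rplus n).zero_mem
  have h1 := (Rplus n).one_mem
  have hcos : ∀ k : ℕ, Real.cos (k * (2 * Real.pi / n)) ∈ Rplus n := by
    intro k
    have h2 : (1 / 2 : ℝ) ∈ Rplus n := Subring.subset_closure (by simp)
    have := (Rplus n).mul_mem h2 (two_mul_cos_mem_Rplus n k)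
    rwa [← mul_assoc, one_div_mul_cancel two_ne_zero, one_mul] at this
  have hc : Real.cos (2 * Real.pi / n) ∈ Rplus n := by simpa using hcos 1
  have hs : Real.sin (2 * Real.pi / n) ∈ Rplus n := by
    obtain ⟨m, rfl⟩ := h4
    obtain ⟨k, rfl⟩ : ∃ k, m = k + 1 := Nat.exists_eq_succ_of_ne_zero (by rintro rfl; simp at hn)
    have e : Real.sin (2 * Real.pi / (4 * (k + 1) : ℕ)) =
        Real.cos (k * (2 * Real.pi / (4 * (k + 1) : ℕ))) := by
      rw [← Real.cos_pi_div_two_sub]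
      congr 1
      have : (k : ℝ) + 1 ≠ 0 := by positivity
      push_cast
      field_simp
      ring
    rw [e]
    exact hcos k
  refine (Subgroup.closure_le _).2 ?_
  rintro _ (rfl | rfl)
  · have e : rotY (2 * Real.pi / (4 : ℕ)) = rotY (Real.pi / 2) := by
      congr 1
      push_cast
      ring
    rw [e]
    intro i j
    fin_cases i <;> fin_cases j <;> simp [rotY, h0, h1]
  · intro i j
    fin_cases i <;> fin_cases j <;> simp [rotZ, h0, h1, hc, hs]

/-! ### The projective unitary group -/

lemma piHom_eq_one_iff (g : U2C) :
    piHom g = 1 ↔ ∃ c : ℂ, (g : Matrix (Fin 2) (Fin 2) ℂ) = c • 1 := by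
  constructor
  · intro h
    have hcomm : ∀ j, (g : Matrix (Fin 2) (Fin 2) ℂ) * pauli j =
        pauli j * (g : Matrix (Fin 2) (Fin 2) ℂ) := by
      intro j
      have h1 : adMatrix g = 1 := congrArg Subtype.val h
      have e := conj_pauli g j
      rw [h1] at e
      have e' : ∑ i, (((1 : Matrix (Fin 3) (Fin 3) ℝ) i j : ℝ) : ℂ) • pauli i = pauli j := by
        rw [Finset.sum_eq_single j] <;> simp +contextual
      rw [e'] at e
      conv_rhs => rw [← e]
      rw [Matrix.mul_assoc, U2C_star_mul, Matrix.mul_one]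
    refine ⟨(g : Matrix (Fin 2) (Fin 2) ℂ) 0 0, ?_⟩
    have hx := congrFun (congrFun (hcomm 0) 0) 1
    have hz := congrFun (congrFun (hcomm 2) 0) 1
    have hz' := congrFun (congrFun (hcomm 2) 1) 0
    simp [pauli, Matrix.mul_apply, Fin.sum_univ_two] at hx hz hz'
    ext i j
    fin_cases i <;> fin_cases j <;> simp
    · linear_combination (-1 / 2 : ℂ) * hz
    · linear_combination (1 / 2 : ℂ) * hz'
    · exact hx.symm
  · rintro ⟨c, hc⟩
    have hg := U2C_mul_star g
    apply Subtype.ext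
    change adMatrix g = 1
    rw [← adMatrix_one]
    ext i j
    have e : (g : Matrix (Fin 2) (Fin 2) ℂ) * pauli j * (g : Matrix (Fin 2) (Fin 2) ℂ)ᴴ =
        1 * pauli j * 1ᴴ := by
      have : (g : Matrix (Fin 2) (Fin 2) ℂ) * pauli j =
          pauli j * (g : Matrix (Fin 2) (Fin 2) ℂ) := by simp [hc]
      rw [this, Matrix.mul_assoc, hg]
      simp
    change ((pauli i * _).trace / 2).re = ((pauli i * _).trace / 2).re
    rw [e]

/-- The homomorphism `PU₂(A) → SO₃` induced by `π`. -/
noncomputable def projPi (A : Subring ℂ) : PU2 A →* SO3 :=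
  QuotientGroup.lift (scalars A) (piHom.comp (U2 A).subtype) fun g hg =>
    (piHom_eq_one_iff (g : U2C)).2 hg

lemma projPi_injective (A : Subring ℂ) : Function.Injective (projPi A) := by
  rw [injective_iff_map_eq_one]
  intro x hx
  induction x using QuotientGroup.induction_on with
  | H g => exact (QuotientGroup.eq_one_iff g).2 ((piHom_eq_one_iff (g : U2C)).1 hx)

lemma PG_map_projPi {n : ℕ} (h4 : 4 ∣ n) (hn : n ≠ 0) :
    (PG n).map (projPi (R n)) = piG n := by
  have e : (projPi (R n)).comp (QuotientGroup.mk' (scalars (R n))) =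
      piHom.comp (U2 (R n)).subtype := rfl
  rw [PG, Subgroup.map_map, e, ← Subgroup.map_map, Subgroup.subgroupOf_map_subtype,
    inf_eq_left.2 (G_le_U2 h4 hn), piG]

end CliffordCyclotomic

theorem mainTheorem4 (n : ℕ) (h4 : 4 ∣ n) (h8 : 8 ≤ n) :
    (∃ e : CliffordCyclotomic.PG n ≃* CliffordCyclotomic.piG n,
      ∀ (g : CliffordCyclotomic.U2 (CliffordCyclotomic.R n))
        (hg : (QuotientGroup.mk g : CliffordCyclotomic.PU2 (CliffordCyclotomic.R n)) ∈
          CliffordCyclotomic.PG n),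
        (e ⟨QuotientGroup.mk g, hg⟩ : CliffordCyclotomic.SO3) = CliffordCyclotomic.piHom g) ∧
    CliffordCyclotomic.piG n ≤ CliffordCyclotomic.SO3R (CliffordCyclotomic.Rplus n) ∧
    CliffordCyclotomic.piG n = CliffordCyclotomic.Grot 4 n ∧
    Nonempty (CliffordCyclotomic.Grot 4 n ≃*
      CliffordCyclotomic.Amalgam CliffordCyclotomic.d4ToS4
        (CliffordCyclotomic.d4ToDn n h4)) := by
  have hn : n ≠ 0 := by omega
  have hpi := CliffordCyclotomic.piG_eq_Grot h4 hn
  refine ⟨⟨((CliffordCyclotomic.PG n).equivMapOfInjective _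
      (CliffordCyclotomic.projPi_injective _)).trans
      (MulEquiv.subgroupCongr (CliffordCyclotomic.PG_map_projPi h4 hn)), fun g hg => rfl⟩,
    hpi ▸ CliffordCyclotomic.Grot_le_SO3R h4 hn, hpi, ⟨?_⟩⟩
  exact ((MonoidHom.ofInjective (CliffordCyclotomic.amalgamHom_injective h4 hn)).trans
    (MulEquiv.subgroupCongr (CliffordCyclotomic.amalgamHom_range h4 hn))).symm
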